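/- Call $(X,\mathfrak A,\mu,T)$ a measure-preserving system if $(X,\mathfrak A,\mu)$ is a probability space and $T:X\to X$ is measurable with $\mu(T^{-1}A)=\mu(A)$ for all $A\in\mathfrak A$. It is ergodic if every $A\in\mathfrak A$ with $T^{-1}A=A$ has $\mu(A)\in\{0,1\}$, and invertible if $T$ has a measurable inverse up to null sets, that is, if there is a measurable $R:X\to X$ with $R(Tx)=x$ and $T(Rx)=x$ for $\mu$-almost every $x$ (for example, if $T$ is a bijection with measurable inverse). The Kronecker factor $\mathcal K\subseteq L^2(X,\mu)$ is the closed linear span in $L^2(X,\mu)$ (complex scalars) of the eigenfunctions of $T$, i.e. of the $h\in L^2(X,\mu)$, $h\neq 0$, with $h\circ T=\lambda h$ for some $\lambda\in\mathbb C$. **Theorem.** Let $(X,\mathfrak A,\mu,T)$ be an invertible ergodic measure-preserving system and let $f:X\to\mathbb C$ represent an element of $\mathcal K^{\perp}\cap L^\infty(X,\mu)$. Then there is a set $X'\in\mathfrak A$ with $\mu(X')=1$ such that for every invertible ergodic measure-preserving system $(Y,\mathfrak B,\nu,S)$, every $g\in L^\infty(Y,\nu)$ and every $x\in X'$, $$\lim_{N\to\infty}\frac1N\sum_{n=1}^N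 f(T^nx)\,g(S^ny)=0\qquad\text{for }\nu\text{-almost every }y\in Y.$$ In particular, $X'$ does not depend on $(Y,\mathfrak B,\nu,S)$ or $g$. -/

import Mathlib

universe u v

open MeasureTheory Filter Topology

/-- `T` is invertible as a map of the measure space `(X, μ)`: it has a measurable inverse up to
null sets. Every bijection that is measurable together with its inverse is an example. -/
def IsInvertibleMod {X : Type*} [MeasurableSpace X] (T : X → X) (μ : Measure X) : Prop :=
  ∃ R : X → X, Measurable R ∧ R ∘ T =ᵐ[μ] id ∧ T ∘ R =ᵐ[μ] id

/-- The Koopman operator `h ↦ h ∘ T` on the complex Hilbert space `L²(X, μ)`. -/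
noncomputable def koopman {X : Type*} [MeasurableSpace X] {μ : Measure X} {T : X → X}
    (hT : MeasurePreserving T μ μ) : Lp ℂ 2 μ →ₗ[ℂ] Lp ℂ 2 μ :=
  Lp.compMeasurePreservingₗ ℂ T hT

/-- The Kronecker factor: the closed linear span in `L²(X, μ)` of the eigenfunctions of `T`. -/
noncomputable def kroneckerFactor {X : Type*} [MeasurableSpace X] {μ : Measure X} {T : X → X}
    (hT : MeasurePreserving T μ μ) : Submodule ℂ (Lp ℂ 2 μ) :=
  (Submodule.span ℂ
    {h : Lp ℂ 2 μ | ∃ c : ℂ, Module.End.HasEigenvector (koopman hT) c h}).topologicalClosure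

/-! The argument is of Bourgain–Furstenberg–Katznelson–Ornstein type: everything needed about `x` is
a property of the single sequence `a k = f (T^k x)`, namely `IsSelfUncorrelated a`, after which `(Y,
S)` and `g` are arbitrary.

From orthogonality to vanishing correlation: the mean ergodic theorem on `L²(μ × μ)` gives a limit
for the orbit averages of `f ⊗ conj f`. Read as integral operators, these averages converge in norm
to a compact self-adjoint operator commuting with the Koopman isometry. Its nonzero eigenspaces are
finite-dimensional and invariant, hence spanned by eigenfunctions, so it kills `f` and the limit is
zero (`tendsto_birkhoffAverage_tensor_zero`). A maximal inequality makes this pointwise: for almost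
all pairs the orbits of `x` and `ξ` decorrelate (`ae_ae_tendsto_correlation_zero`). If `x` is
moreover generic for countably many pattern sets, `ξ` may be replaced by most shifts of `x`
(`ae_isSelfUncorrelated`).

From the sequence to all systems: if the averages against `g (S^k y)` stay large infinitely often on
a set of positive measure, then some orbit piece of length `J` correlates with copies of initial
blocks of `a` at each of `K` widely separated scales. Blocks packed at different scales are almost
orthogonal, so their sum has energy of order `K * J` but correlation of order `K * J` with a bounded
sequence; Cauchy–Schwarz forbids this for large `K` (`exists_multiscale_sequence`,
`ae_not_frequently_le_re_of_isSelfUncorrelated`). -/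

open scoped ComplexConjugate

/-! ### Correlated windows and greedy packing of blocks -/

/-- Some window of length between `L` and `M` at position `n` of `c` has normalized correlation
larger than `δ` with the initial segment of `a`. -/
def HasLargeCorr (a c : ℕ → ℂ) (δ : ℝ) (L M n : ℕ) : Prop :=
  ∃ l, L ≤ l ∧ l ≤ M ∧ δ * l < ‖∑ k ∈ Finset.range l, a k * conj (c (n + k))‖

theorem HasLargeCorr.congr {a c c' : ℕ → ℂ} {δ : ℝ} {L M n m : ℕ}
    (h : HasLargeCorr a c δ L M n) (hc : ∀ k < M, c (n + k) = c' (m + k)) :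
    HasLargeCorr a c' δ L M m := by
  obtain ⟨l, h1, h2, h3⟩ := h
  refine ⟨l, h1, h2, h3.trans_eq ?_⟩
  congr 1
  refine Finset.sum_congr rfl fun k hk => ?_
  rw [hc k (by have := Finset.mem_range.1 hk; omega)]

theorem HasLargeCorr.mono {a c : ℕ → ℂ} {δ : ℝ} {L M M' n : ℕ}
    (h : HasLargeCorr a c δ L M n) (hM : M ≤ M') : HasLargeCorr a c δ L M' n := by
  obtain ⟨l, h1, h2, h3⟩ := h
  exact ⟨l, h1, h2.trans hM, h3⟩

theorem not_hasLargeCorr_zero {a : ℕ → ℂ} {δ : ℝ} (hδ : 0 ≤ δ) {L M n : ℕ} :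
    ¬ HasLargeCorr a (fun _ => 0) δ L M n := by
  rintro ⟨l, -, -, h⟩
  have : (0 : ℝ) ≤ δ * l := by positivity
  simp at h
  linarith

open Classical in
/-- At the length scale `L`, the positions at which `a` correlates with itself through windows of
length at most `M` are rare, and `M` is small compared with `L`. -/
def SparseAtScale (a : ℕ → ℂ) (δ : ℝ) (L₀ M L : ℕ) : Prop :=
  (M : ℝ) ≤ δ * L ∧ ∀ N, L ≤ N →
    (((Finset.range N).filter fun m => HasLargeCorr a a δ L₀ M m).card : ℝ) ≤ δ * N

open Classical in
theorem SparseAtScale.mono {a : ℕ → ℂ} {δ : ℝ} {L₀ M M' L : ℕ}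
    (h : SparseAtScale a δ L₀ M L) (hM : M' ≤ M) : SparseAtScale a δ L₀ M' L := by
  refine ⟨le_trans (by exact_mod_cast hM) h.1, fun N hN => le_trans ?_ (h.2 N hN)⟩
  exact_mod_cast Finset.card_le_card
    (Finset.monotone_filter_right _ fun n _ hn => HasLargeCorr.mono hn hM)

/-- The sequence with a copy of the first `l` terms of `a` at position `s`, zero before and `c`
after. -/
noncomputable def insertBlock (a c : ℕ → ℂ) (s l : ℕ) (n : ℕ) : ℂ :=
  if n < s then 0 else if n < s + l then a (n - s) else c n

theorem sum_insertBlock (a c v : ℕ → ℂ) {s l J : ℕ} (h : s + l ≤ J) :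
    ∑ n ∈ Finset.Ico s J, insertBlock a c s l n * v n =
      ∑ k ∈ Finset.range l, a k * v (s + k) + ∑ n ∈ Finset.Ico (s + l) J, c n * v n := by
  rw [← Finset.sum_Ico_consecutive _ (Nat.le_add_right s l) h, Finset.sum_Ico_eq_sum_range]
  congr 1
  · rw [Nat.add_sub_cancel_left]
    refine Finset.sum_congr rfl fun k hk => ?_
    have := Finset.mem_range.1 hk
    simp [insertBlock, this]
  · refine Finset.sum_congr rfl fun k hk => ?_
    have := Finset.mem_Ico.1 hk
    rw [insertBlock, if_neg (by omega), if_neg (by omega)]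

-- A bad window starting before position `s + l` either crosses one of the two ends of the block,
-- which leaves at most `M ≤ δ * l` starting points for each, or lies inside the block, where it is
-- a correlation of `a` with itself and has at most `δ * l` starting points. This accounts for the
-- factor `3`.
open Classical in
theorem card_hasLargeCorr_insertBlock_le {a c : ℕ → ℂ} {δ : ℝ} (hδ : 0 ≤ δ) {L₀ M L s l J : ℕ}
    (h : SparseAtScale a δ L₀ M L) (hl : L ≤ l) :
    (((Finset.range J).filter
        fun n => HasLargeCorr a (insertBlock a c s l) δ L₀ M n).card : ℝ) ≤
      3 * δ * l + ((Finset.range J).filter fun n => HasLargeCorr a c δ L₀ M n).card := by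
  have hM : (M : ℝ) ≤ δ * l := h.1.trans (by gcongr)
  have hsub : ((Finset.range J).filter fun n => HasLargeCorr a (insertBlock a c s l) δ L₀ M n) ⊆
      (Finset.Ico (s - M) s ∪ ((Finset.range l).filter fun m => HasLargeCorr a a δ L₀ M m).image
        (fun m => s + m)) ∪ (Finset.Ico (s + l - M) (s + l) ∪
          (Finset.range J).filter fun n => HasLargeCorr a c δ L₀ M n) := by
    intro n hn
    obtain ⟨hnJ, hn⟩ := Finset.mem_filter.1 hn
    simp only [Finset.mem_union, Finset.mem_image, Finset.mem_Ico, Finset.mem_filter,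
      Finset.mem_range] at hnJ ⊢
    by_cases h1 : n + M ≤ s
    · exact absurd (hn.congr (c' := fun _ => 0) (m := n) fun k hk => by
        rw [insertBlock, if_pos (by omega)]) (not_hasLargeCorr_zero hδ)
    by_cases h2 : n < s
    · left; left; omega
    by_cases h3 : n + M ≤ s + l
    · by_cases hM0 : M = 0
      · obtain ⟨t, -, ht, h⟩ := hn
        obtain rfl : t = 0 := by omega
        simp at h
      · left; right
        refine ⟨n - s, ⟨by omega, hn.congr fun k hk => ?_⟩, by omega⟩
        rw [insertBlock, if_neg (by omega), if_pos (by omega)]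
        congr 1; omega
    by_cases h4 : n < s + l
    · right; left; omega
    · right; right
      exact ⟨hnJ, hn.congr fun k hk => by rw [insertBlock, if_neg (by omega), if_neg (by omega)]⟩
  have hc := (Finset.card_le_card hsub).trans
    ((Finset.card_union_le _ _).trans (add_le_add (Finset.card_union_le _ _)
      (Finset.card_union_le _ _)))
  have h1 : (Finset.Ico (s - M) s).card ≤ M := by simp; omega
  have h2 : (Finset.Ico (s + l - M) (s + l)).card ≤ M := by simp; omega
  have h3 := (Finset.card_image_le (s := (Finset.range l).filter
    fun m => HasLargeCorr a a δ L₀ M m) (f := fun m => s + m))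
  have h4 := h.2 l hl
  have hc' := hc.trans (add_le_add (add_le_add h1 h3) (add_le_add_left h2 _))
  have hc'' : (((Finset.range J).filter
        fun n => HasLargeCorr a (insertBlock a c s l) δ L₀ M n).card : ℝ) ≤ _ :=
    Nat.cast_le.2 hc'
  push_cast at hc''
  linarith

open Classical in
/-- Greedy packing of blocks: the blocks placed at points of `E` cover `E`. -/
theorem exists_block_packing {a b V : ℕ → ℂ} {α η δ : ℝ} {L₀ L J : ℕ} (ha : ∀ k, ‖a k‖ ≤ 1)
    (hα : 0 ≤ α) (hη : 0 ≤ η) (hδ : 0 ≤ δ) (hL : 0 < L) (E : Set ℕ)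
    (hE : ∀ n ∈ E, ∃ l, L ≤ l ∧ n + l ≤ J ∧
      α * l ≤ (∑ k ∈ Finset.range l, a k * b (n + k)).re ∧
      ‖∑ k ∈ Finset.range l, a k * conj (V (n + k))‖ ≤ η * l) (d : ℕ) :
    ∀ s, s + d = J → ∃ c : ℕ → ℂ, (∀ n < s, c n = 0) ∧ (∀ n, ‖c n‖ ≤ 1) ∧
      α * ((Finset.Ico s J).filter fun n => n ∈ E).card ≤
        (∑ n ∈ Finset.Ico s J, c n * b n).re ∧
      ‖∑ n ∈ Finset.Ico s J, c n * conj (V n)‖ ≤ η * d ∧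
      ∀ M, SparseAtScale a δ L₀ M L →
        (((Finset.range J).filter fun n => HasLargeCorr a c δ L₀ M n).card : ℝ) ≤ 3 * δ * d := by
  induction d using Nat.strong_induction_on with
  | _ d ih =>
  intro s hs
  rcases Nat.eq_zero_or_pos d with rfl | hd
  · refine ⟨fun _ => 0, by simp, by simp, ?_, by simp, fun M _ => ?_⟩
    · obtain rfl : s = J := by omega
      simp
    · simp [not_hasLargeCorr_zero hδ]
  by_cases hsE : s ∈ E
  -- Greedy choice: use the block available at `s` and continue at `s + l`. The `l` positions passed
  -- over contribute at most `α * l` to the left side, which this block pays for by itself.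
  · obtain ⟨l, hLl, hlJ, h1, h2⟩ := hE s hsE
    obtain ⟨c, hc0, hc1, hc2, hc3, hc4⟩ := ih (d - l) (by omega) (s + l) (by omega)
    have hd' : ((d - l : ℕ) : ℝ) = d - l := by rw [Nat.cast_sub (by omega)]
    rw [hd'] at hc3 hc4
    refine ⟨insertBlock a c s l, fun n hn => if_pos hn, fun n => ?_, ?_, ?_, fun M hM => ?_⟩
    · unfold insertBlock; split_ifs <;> simp [ha, hc1]
    · rw [sum_insertBlock a c b hlJ, Complex.add_re]
      have hcard : ((Finset.Ico s J).filter fun n => n ∈ E).card ≤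
          l + ((Finset.Ico (s + l) J).filter fun n => n ∈ E).card := by
        rw [← Finset.Ico_union_Ico_eq_Ico (Nat.le_add_right s l) hlJ, Finset.filter_union]
        refine (Finset.card_union_le _ _).trans (Nat.add_le_add_right ?_ _)
        exact (Finset.card_filter_le _ _).trans (by simp)
      have hcard' : (((Finset.Ico s J).filter fun n => n ∈ E).card : ℝ) ≤ 
          l + ((Finset.Ico (s + l) J).filter fun n => n ∈ E).card := by exact_mod_cast hcard
      nlinarith [mul_le_mul_of_nonneg_left hcard' hα]
    · rw [sum_insertBlock a c (fun n => conj (V n)) hlJ]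
      refine (norm_add_le _ _).trans ?_
      linarith
    · have := card_hasLargeCorr_insertBlock_le (c := c) (s := s) (J := J) hδ hM hLl
      have := hc4 M hM
      linarith
  · obtain ⟨c, hc0, hc1, hc2, hc3, hc4⟩ := ih (d - 1) (by omega) (s + 1) (by omega)
    have hd' : ((d - 1 : ℕ) : ℝ) = d - 1 := by rw [Nat.cast_sub (by omega)]; simp
    rw [hd'] at hc3 hc4
    have hsplit : Finset.Ico s J = insert s (Finset.Ico (s + 1) J) := by
      ext n; simp only [Finset.mem_Ico, Finset.mem_insert]; omega
    have hnot : s ∉ Finset.Ico (s + 1) J := by simp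
    refine ⟨c, fun n hn => hc0 n (by omega), hc1, ?_, ?_, fun M hM => ?_⟩
    · rw [hsplit, Finset.sum_insert hnot, Finset.filter_insert, if_neg hsE, hc0 s (by omega)]
      simpa using hc2
    · rw [hsplit, Finset.sum_insert hnot, hc0 s (by omega), zero_mul, zero_add]
      linarith
    · have := hc4 M hM
      linarith

/-! ### Superposing blocks of many scales -/

theorem HasLargeCorr.of_add {a c c' : ℕ → ℂ} {δ δ' : ℝ} {L M n : ℕ}
    (h : HasLargeCorr a (fun n => c n + c' n) (δ + δ') L M n) :
    HasLargeCorr a c δ L M n ∨ HasLargeCorr a c' δ' L M n := by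
  obtain ⟨l, h1, h2, h3⟩ := h
  by_contra! hcon
  have h4 : ‖∑ k ∈ Finset.range l, a k * conj (c (n + k))‖ ≤ δ * l :=
    not_lt.1 fun h => hcon.1 ⟨l, h1, h2, h⟩
  have h5 : ‖∑ k ∈ Finset.range l, a k * conj (c' (n + k))‖ ≤ δ' * l :=
    not_lt.1 fun h => hcon.2 ⟨l, h1, h2, h⟩
  have h6 := norm_add_le (∑ k ∈ Finset.range l, a k * conj (c (n + k)))
    (∑ k ∈ Finset.range l, a k * conj (c' (n + k)))
  rw [← Finset.sum_add_distrib] at h6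
  simp only [map_add, mul_add] at h3
  linarith

open Classical in
/-- A sequence that correlates with `b` at each of `K` scales, and whose energy is that of `K`
almost orthogonal sequences. -/
theorem exists_multiscale_sequence {a b : ℕ → ℂ} {α δ : ℝ} {L₀ J : ℕ} (ha : ∀ k, ‖a k‖ ≤ 1)
    (hα : 0 ≤ α) (hδ : 0 ≤ δ) (K : ℕ) :
    ∀ (L M : ℕ → ℕ) (E : ℕ → Set ℕ), (∀ j, 0 < L j) → (∀ j, L₀ ≤ L j) →
      (∀ i j, i < j → SparseAtScale a δ L₀ (M i) (L j)) → (∀ j < K, (M j : ℝ) ≤ δ * J) →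
      (∀ j, ∀ n ∈ E j, ∃ l, L j ≤ l ∧ l ≤ M j ∧
        α * l ≤ (∑ k ∈ Finset.range l, a k * b (n + k)).re) →
      ∃ V : ℕ → ℂ,
        α * (∑ j ∈ Finset.range K, (((Finset.range J).filter fun n => n ∈ E j).card : ℝ) -
          4 * K ^ 2 * δ * J) ≤ (∑ n ∈ Finset.range J, V n * b n).re ∧
        ∑ n ∈ Finset.range J, ‖V n‖ ^ 2 ≤ (K + K ^ 2 * δ) * J ∧
        ∀ M', (∀ j < K, SparseAtScale a δ L₀ M' (L j)) →
          (((Finset.range J).filter fun n => HasLargeCorr a V (K * δ) L₀ M' n).card : ℝ) ≤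
            3 * K * δ * J := by
  induction K with
  | zero =>
    intro L M E _ _ _ _ _
    exact ⟨fun _ => 0, by simp, by simp, fun M' _ => by simp [not_hasLargeCorr_zero]⟩
  | succ K ih =>
    intro L M E hL hL₀ hs hJ hE
    -- The larger scales are handled first and scale `0`, the smallest, is added last: its short
    -- windows see mostly the interior of the long blocks in `V`, where only self-correlations of
    -- `a` occur.
    obtain ⟨V, hV1, hV2, hV3⟩ := ih (fun j => L (j + 1)) (fun j => M (j + 1)) (fun j => E (j + 1))
      (fun j => hL _) (fun j => hL₀ _) (fun i j hij => hs _ _ (by omega))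
      (fun j hj => hJ _ (by omega)) (fun j => hE _)
    -- Blocks are placed only where they fit into `[0, J)` and are nearly orthogonal to `V`. This
    -- discards at most `3 * K * δ * J` and `δ * J` points of `E 0`.
    obtain ⟨E', hE'⟩ : ∃ E' : Set ℕ, ∀ n, n ∈ E' ↔
        n ∈ E 0 ∧ n + M 0 ≤ J ∧ ¬ HasLargeCorr a V (K * δ) L₀ (M 0) n :=
      ⟨{n | _}, fun _ => Iff.rfl⟩
    have hη : 0 ≤ (K : ℝ) * δ := by positivity
    obtain ⟨c, -, hc1, hc2, hc3, hc4⟩ := exists_block_packing (b := b) (V := V) (L₀ := L₀) ha hα hη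
      hδ (hL 0) E' (J := J) (by
        intro n hn'
        obtain ⟨hn, hnJ, hnV⟩ := (hE' n).1 hn'
        obtain ⟨l, h1, h2, h3⟩ := hE 0 n hn
        exact ⟨l, h1, by omega, h3, not_lt.1 fun h => hnV ⟨l, (hL₀ 0).trans h1, h2, h⟩⟩)
      J 0 (by simp)
    rw [← Finset.range_eq_Ico] at hc2 hc3
    have hJ0 := hJ 0 (by omega)
    have hV0 := hV3 (M 0) fun j _ => hs 0 (j + 1) (by omega)
    have hcard : (((Finset.range J).filter fun n => n ∈ E 0).card : ℝ) ≤
        ((Finset.range J).filter fun n => n ∈ E').card +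
          ((Finset.range J).filter fun n => HasLargeCorr a V (K * δ) L₀ (M 0) n).card + M 0 := by
      have hsub : ((Finset.range J).filter fun n => n ∈ E 0) ⊆
          ((Finset.range J).filter fun n => n ∈ E') ∪
          ((Finset.range J).filter fun n => HasLargeCorr a V (K * δ) L₀ (M 0) n) ∪
          Finset.Ico (J - M 0) J := by
        intro n hn
        simp only [Finset.mem_union, Finset.mem_filter, Finset.mem_range, Finset.mem_Ico,
          hE'] at hn ⊢
        by_cases h1 : n + M 0 ≤ J
        · by_cases h2 : HasLargeCorr a V (K * δ) L₀ (M 0) n <;> tauto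
        · right; omega
      have h := (Finset.card_le_card hsub).trans ((Finset.card_union_le _ _).trans
        (Nat.add_le_add (Finset.card_union_le _ _) (show _ ≤ M 0 by simp; omega)))
      exact_mod_cast h
    refine ⟨fun n => V n + c n, ?_, ?_, fun M' hM' => ?_⟩
    · rw [Finset.sum_range_succ']
      simp only [add_mul, Finset.sum_add_distrib, Complex.add_re]
      have h5 := mul_le_mul_of_nonneg_left (show
        (((Finset.range J).filter fun n => n ∈ E 0).card : ℝ) - 3 * K * δ * J - δ * J ≤
          ((Finset.range J).filter fun n => n ∈ E').card by linarith) hα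
      -- The slack is `4 * (K + 1) ^ 2 - 4 * K ^ 2 - (3 * K + 1) = 5 * K + 3`.
      have h6 : 0 ≤ α * ((5 * K + 3) * (δ * J)) := by positivity
      refine le_trans ?_ (add_le_add hV1 (h5.trans hc2))
      rw [← sub_nonneg]
      refine h6.trans_eq ?_
      push_cast
      ring
    · have h7 : ∀ n, ‖V n + c n‖ ^ 2 = ‖V n‖ ^ 2 + ‖c n‖ ^ 2 + 2 * (c n * conj (V n)).re := by
        intro n
        rw [add_comm (V n), Complex.sq_norm, Complex.normSq_add, Complex.sq_norm, Complex.sq_norm]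
        ring
      simp only [h7, Finset.sum_add_distrib, ← Finset.mul_sum]
      rw [← Complex.re_sum]
      have h8 := (Complex.re_le_norm _).trans hc3
      have h9 : ∑ n ∈ Finset.range J, ‖c n‖ ^ 2 ≤ J := by
        refine (Finset.sum_le_card_nsmul _ _ 1 fun n _ => ?_).trans (by simp)
        exact pow_le_one₀ (norm_nonneg _) (hc1 n)
      have h10 : 0 ≤ δ * J := by positivity
      push_cast
      linarith
    · have h1 := hV3 M' fun j hj => hM' _ (by omega)
      have h2 := hc4 M' (hM' 0 (by omega))
      have hsub : ((Finset.range J).filter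
          fun n => HasLargeCorr a (fun n => V n + c n) (((K + 1 : ℕ) : ℝ) * δ) L₀ M' n) ⊆
          ((Finset.range J).filter fun n => HasLargeCorr a V (K * δ) L₀ M' n) ∪
          ((Finset.range J).filter fun n => HasLargeCorr a c δ L₀ M' n) := by
        intro n hn
        simp only [Finset.mem_union, Finset.mem_filter] at hn ⊢
        have := HasLargeCorr.of_add (δ := K * δ) (δ' := δ) (c := V) (c' := c)
          (by convert hn.2 using 1; push_cast; ring)
        tauto
      have h := (Finset.card_le_card hsub).trans (Finset.card_union_le _ _)
      have h' : (_ : ℝ) ≤ _ := Nat.cast_le.2 h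
      push_cast at h' ⊢
      linarith

/-! ### Self-uncorrelated sequences and the choice of scales -/

open Classical in
/-- For every `δ`, long enough windows of `a` have normalized correlation above `δ` with the
beginning of `a` only with frequency at most `δ`. -/
def IsSelfUncorrelated (a : ℕ → ℂ) : Prop :=
  ∀ δ : ℝ, 0 < δ → ∃ L₀ : ℕ, ∀ M : ℕ, ∀ᶠ N : ℕ in atTop,
    (((Finset.range N).filter fun m => HasLargeCorr a a δ L₀ M m).card : ℝ) ≤ δ * N

theorem IsSelfUncorrelated.exists_sparseAtScale {a : ℕ → ℂ} (h : IsSelfUncorrelated a) {δ : ℝ}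
    (hδ : 0 < δ) :
    ∃ L₀ : ℕ, ∀ M C : ℕ, ∃ L, C ≤ L ∧ SparseAtScale a δ L₀ M L := by
  obtain ⟨L₀, hL₀⟩ := h δ hδ
  refine ⟨L₀, fun M C => ?_⟩
  obtain ⟨N₀, hN₀⟩ := eventually_atTop.1 (hL₀ M)
  obtain ⟨t, ht⟩ := exists_nat_ge ((M : ℝ) / δ)
  refine ⟨max C (max N₀ t), le_max_left _ _, ?_, fun N hN => hN₀ N (by omega)⟩
  rw [div_le_iff₀' hδ] at ht
  refine ht.trans ?_
  gcongr
  simp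

/-- Alternating choice of two increasing sequences of scales. -/
theorem exists_scale_sequences {P : ℕ → ℕ → Prop} {Q : ℕ → ℕ → Prop}
    (hP : ∀ L, ∃ M, L ≤ M ∧ P L M) (C : ℕ) (hQ : ∀ M, ∃ L, C ≤ L ∧ M ≤ L ∧ Q M L)
    (hQm : ∀ M M' L, M' ≤ M → Q M L → Q M' L) :
    ∃ L M : ℕ → ℕ, (∀ j, C ≤ L j) ∧ (∀ j, P (L j) (M j)) ∧ Monotone M ∧
      ∀ i j, i < j → Q (M i) (L j) := by
  choose m hm hPm using hP
  choose l hCl hl hQl using hQ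
  let L : ℕ → ℕ := fun j => Nat.rec C (fun _ x => l (m x)) j
  have hLs : ∀ j, L (j + 1) = l (m (L j)) := fun _ => rfl
  have hmono : Monotone fun j => m (L j) := by
    refine monotone_nat_of_le_succ fun j => ?_
    rw [hLs]
    exact (hl _).trans (hm _)
  refine ⟨L, fun j => m (L j), fun j => ?_, fun j => hPm _, hmono, fun i j hij => ?_⟩
  · cases j with
    | zero => exact le_rfl
    | succ j => exact hCl _
  · obtain ⟨j, rfl⟩ : ∃ t, j = t + 1 := ⟨j - 1, by omega⟩
    exact hQm _ _ _ (hmono (by omega : i ≤ j)) (hQl _)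

/-! ### Self-uncorrelated weights annihilate averages in every system -/

section Orbits

variable {Y : Type*} [MeasurableSpace Y] {ν : Measure Y} [IsProbabilityMeasure ν] {S : Y → Y}

theorem exists_le_measureReal_iUnion_of_frequently {s : ℕ → Set Y}
    {β : ℝ} (hβ : β < ν.real {y | ∃ᶠ n in atTop, y ∈ s n})
    (L : ℕ) : ∃ M, L ≤ M ∧ β ≤ ν.real {y | ∃ l, L ≤ l ∧ l ≤ M ∧ y ∈ s l} := by
  have hmono : Monotone fun M => {y | ∃ l, L ≤ l ∧ l ≤ M ∧ y ∈ s l} :=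
    fun M M' h y ⟨l, h1, h2, h3⟩ => ⟨l, h1, h2.trans h, h3⟩
  have ht := tendsto_measure_iUnion_atTop (μ := ν) hmono
  have hsub : {y | ∃ᶠ n in atTop, y ∈ s n} ⊆ ⋃ M, {y | ∃ l, L ≤ l ∧ l ≤ M ∧ y ∈ s l} := by
    intro y hy
    obtain ⟨l, hl, hy⟩ := frequently_atTop.1 hy L
    exact Set.mem_iUnion.2 ⟨l, l, hl, le_rfl, hy⟩
  have ht' := (ENNReal.tendsto_toReal (measure_ne_top ν _)).comp ht
  have hlt := hβ.trans_le (measureReal_mono (μ := ν) hsub)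
  obtain ⟨M, hM1, hM2⟩ := ((ht'.eventually_const_lt hlt).and (eventually_ge_atTop L)).exists
  exact ⟨M, hM2, hM1.le⟩

-- By invariance of `ν` the total number of visits has mean at least `K * β * J`, and some `y`
-- attains the mean. A single orbit thus serves all `K` scales at once.
open Classical in
theorem exists_orbit_visits (hS : MeasurePreserving S ν ν) {B : ℕ → Set Y}
    (hB : ∀ j, MeasurableSet (B j)) {β : ℝ} (hβ : ∀ j, β ≤ ν.real (B j)) (K J : ℕ) :
    ∃ y, K * β * J ≤ ∑ j ∈ Finset.range K,
      (((Finset.range J).filter fun n => S^[n] y ∈ B j).card : ℝ) := by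
  have hm : ∀ j n, MeasurableSet (S^[n] ⁻¹' B j) := fun j n => (hS.iterate n).measurable (hB j)
  have hi : ∀ j n, Integrable ((S^[n] ⁻¹' B j).indicator (1 : Y → ℝ)) ν := fun j n =>
    (integrable_const (1 : ℝ)).indicator (hm j n)
  have hi2 : ∀ j, Integrable
      (fun y => ∑ n ∈ Finset.range J, (S^[n] ⁻¹' B j).indicator (1 : Y → ℝ) y) ν := fun j =>
    integrable_finsetSum _ fun n _ => hi j n
  obtain ⟨y, hy⟩ := exists_integral_le (integrable_finsetSum (Finset.range K) fun j _ => hi2 j)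
  refine ⟨y, le_trans ?_ (hy.trans_eq ?_)⟩
  · rw [integral_finsetSum _ fun j _ => hi2 j]
    simp_rw [integral_finsetSum _ fun n _ => hi _ n, integral_indicator_one (hm _ _)]
    have : ∀ j n, ν.real (S^[n] ⁻¹' B j) = ν.real (B j) := fun j n =>
      (hS.iterate n).measureReal_preimage (hB j).nullMeasurableSet
    simp_rw [this]
    refine le_trans ?_ (Finset.sum_le_sum fun j _ => Finset.sum_le_sum fun n _ => hβ j)
    simp
    linarith
  · refine Finset.sum_congr rfl fun j _ => ?_
    rw [Finset.card_filter]
    push_cast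
    refine Finset.sum_congr rfl fun n _ => ?_
    simp [Set.indicator_apply]

theorem ae_not_frequently_le_re_of_isSelfUncorrelated (hS : MeasurePreserving S ν ν) {a : ℕ → ℂ}
    (ha : ∀ k, ‖a k‖ ≤ 1) (hu : IsSelfUncorrelated a) {g : Y → ℂ} (hg : Measurable g)
    (hg1 : ∀ y, ‖g y‖ ≤ 1) {α : ℝ} (hα : 0 < α) :
    ∀ᵐ y ∂ν, ¬ ∃ᶠ N : ℕ in atTop, α * N ≤ (∑ k ∈ Finset.range N, a k * g (S^[k] y)).re := by
  classical
  by_contra hcon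
  let s : ℕ → Set Y := fun N => {y | α * N ≤ (∑ k ∈ Finset.range N, a k * g (S^[k] y)).re}
  have hs : ∀ N, MeasurableSet (s N) := fun N => by
    refine measurableSet_le measurable_const (Complex.measurable_re.comp ?_)
    exact Finset.measurable_fun_sum _ fun k _ =>
      (hg.comp (hS.measurable.iterate k)).const_mul _
  have hpos : 0 < ν.real {y | ∃ᶠ N : ℕ in atTop, y ∈ s N} := by
    refine ENNReal.toReal_pos (fun h => hcon ?_) (measure_ne_top _ _)
    rw [ae_iff]
    simp only [not_not]
    exact h
  set β := ν.real {y | ∃ᶠ N : ℕ in atTop, y ∈ s N} / 2 with hβ_def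
  have hβ : 0 < β := by positivity
  have hβlt : β < ν.real {y | ∃ᶠ N : ℕ in atTop, y ∈ s N} := by linarith
  have hβ1 : β ≤ 1 := hβlt.le.trans measureReal_le_one
  -- Cauchy–Schwarz will give `(α * K * β * J / 2) ^ 2 ≤ 2 * K * J ^ 2`, that is `K * α ^ 2 * β ^ 2
  -- ≤ 8`. The choice of `δ` below makes the loss `4 * K ^ 2 * δ * J` exactly half of `K * β * J`.
  obtain ⟨K, hK⟩ := exists_nat_gt (8 / (α ^ 2 * β ^ 2))
  have hK0 : (0 : ℝ) < K := lt_trans (by positivity) hK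
  rw [div_lt_iff₀ (by positivity)] at hK
  set δ := β / (8 * K) with hδ_def
  have hδ : 0 < δ := by positivity
  have hKδ : K * δ = β / 8 := by rw [hδ_def]; field_simp
  obtain ⟨L₀, hL₀⟩ := hu.exists_sparseAtScale hδ
  obtain ⟨L, M, hL, hPM, hM, hQ⟩ := exists_scale_sequences
    (exists_le_measureReal_iUnion_of_frequently hβlt) (max 1 L₀)
    (Q := SparseAtScale a δ L₀)
    (fun M => by
      obtain ⟨L, h1, h2⟩ := hL₀ M (max (max 1 L₀) M)
      exact ⟨L, by omega, by omega, h2⟩)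
    (fun M M' L h h' => h'.mono h)
  -- All scales are fixed before `J`, so `J` can be taken long compared with the largest of them.
  obtain ⟨J', hJ'⟩ := exists_nat_ge (M K / δ)
  set J := J' + 1
  have hJ0 : (0 : ℝ) < J := by positivity
  have hJ : (M K : ℝ) ≤ δ * J := by
    rw [div_le_iff₀' hδ] at hJ'
    exact hJ'.trans (by gcongr; simp [J])
  obtain ⟨y, hy⟩ := exists_orbit_visits (ν := ν) hS
    (B := fun j => {y | ∃ l, L j ≤ l ∧ l ≤ M j ∧ y ∈ s l}) (fun j => by
      have : {y | ∃ l, L j ≤ l ∧ l ≤ M j ∧ y ∈ s l} = ⋃ l ∈ Finset.Icc (L j) (M j), s l := by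
        ext; simp [and_assoc]
      rw [this]
      exact Finset.measurableSet_biUnion _ fun l _ => hs l) hPM K J
  obtain ⟨V, hV1, hV2, -⟩ := exists_multiscale_sequence (b := fun n => g (S^[n] y)) (L₀ := L₀)
    (J := J) ha hα.le hδ.le K L M (fun j => {n | S^[n] y ∈ {y | ∃ l, L j ≤ l ∧ l ≤ M j ∧ y ∈ s l}})
    (fun j => by have := hL j; omega) (fun j => by have := hL j; omega) hQ
    (fun j hj => le_trans (by exact_mod_cast hM hj.le) hJ) (by
      rintro j n ⟨l, h1, h2, h3⟩
      refine ⟨l, h1, h2, ?_⟩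
      simpa only [s, Set.mem_ofPred_eq, ← Function.iterate_add_apply, add_comm] using h3)
  have h1 : (∑ n ∈ Finset.range J, V n * g (S^[n] y)).re ≤ ∑ n ∈ Finset.range J, ‖V n‖ := by
    refine (Complex.re_le_norm _).trans ((norm_sum_le _ _).trans (Finset.sum_le_sum fun n _ => ?_))
    rw [norm_mul]
    exact mul_le_of_le_one_right (norm_nonneg _) (hg1 _)
  have h2 := sq_sum_le_card_mul_sum_sq (s := Finset.range J) (f := fun n => ‖V n‖)
  rw [Finset.card_range] at h2
  have h3 : α * (K * β * J / 2) ≤ ∑ n ∈ Finset.range J, ‖V n‖ := by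
    refine le_trans ?_ (hV1.trans h1)
    refine mul_le_mul_of_nonneg_left ?_ hα.le
    have h : 4 * (K : ℝ) ^ 2 * δ * J = K * β * J / 2 := by
      rw [hδ_def]; field_simp; ring
    rw [h]
    have := hy
    simp only [Set.mem_ofPred_eq] at this ⊢
    linarith
  have h4 : (α * (K * β * J / 2)) ^ 2 ≤ J * ((K + K ^ 2 * δ) * J) :=
    (pow_le_pow_left₀ (by positivity) h3 2).trans (h2.trans (by gcongr))
  have h5 : (K : ℝ) + K ^ 2 * δ ≤ 2 * K := by
    have : (K : ℝ) ^ 2 * δ = K * (β / 8) := by rw [← hKδ]; ring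
    nlinarith
  have h6 : (J : ℝ) * ((K + K ^ 2 * δ) * J) ≤ J * ((2 * K) * J) := by gcongr
  have h7 : (K * J ^ 2 : ℝ) * (K * (α ^ 2 * β ^ 2)) ≤ (K * J ^ 2) * 8 := by
    nlinarith [h4.trans h6]
  exact absurd (le_of_mul_le_mul_left h7 (by positivity)) (not_le.2 hK)

theorem ae_tendsto_of_isSelfUncorrelated (hS : MeasurePreserving S ν ν) {a : ℕ → ℂ}
    (ha : ∀ k, ‖a k‖ ≤ 1) (hu : IsSelfUncorrelated a) {g : Y → ℂ} (hg : Measurable g)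
    (hg1 : ∀ y, ‖g y‖ ≤ 1) :
    ∀ᵐ y ∂ν, Tendsto (fun N : ℕ => (N : ℂ)⁻¹ * ∑ k ∈ Finset.range N, a k * g (S^[k] y))
      atTop (𝓝 0) := by
  -- The rotations `u = 1, -1, I, -I` turn one-sided bounds on real parts into a bound on the norm.
  have key : ∀ u : ℂ, ‖u‖ = 1 → ∀ m : ℕ, ∀ᵐ y ∂ν, ∀ᶠ N : ℕ in atTop,
      (u * ∑ k ∈ Finset.range N, a k * g (S^[k] y)).re < 1 / (m + 1) * N := by
    intro u hu1 m
    filter_upwards [ae_not_frequently_le_re_of_isSelfUncorrelated hS ha hu (g := fun y => u * g y)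
      (hg.const_mul u) (fun y => by simpa [hu1] using hg1 y) (α := 1 / (m + 1)) (by positivity)]
      with y hy
    filter_upwards [not_frequently.1 hy] with N hN
    refine lt_of_eq_of_lt ?_ (not_le.1 hN)
    rw [Finset.mul_sum]
    congr 1
    exact Finset.sum_congr rfl fun k _ => by ring
  filter_upwards [ae_all_iff.2 (key 1 (by simp)), ae_all_iff.2 (key (-1) (by simp)),
    ae_all_iff.2 (key Complex.I (by simp)), ae_all_iff.2 (key (-Complex.I) (by simp))]
    with y h1 h2 h3 h4
  rw [Metric.tendsto_atTop']
  intro ε hε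
  obtain ⟨m, hm⟩ := exists_nat_one_div_lt (half_pos hε)
  obtain ⟨N₀, hN₀⟩ := eventually_atTop.1
    (((h1 m).and (h2 m)).and ((h3 m).and ((h4 m).and (eventually_gt_atTop 0))))
  refine ⟨N₀, fun N hN => ?_⟩
  obtain ⟨⟨e1, e2⟩, e3, e4, hN0⟩ := hN₀ N hN.le
  have hNpos : (0 : ℝ) < N := by exact_mod_cast hN0
  generalize (∑ k ∈ Finset.range N, a k * g (S^[k] y)) = z at *
  simp at e1 e2 e3 e4
  rw [dist_zero_right, norm_mul, norm_inv, Complex.norm_natCast, inv_mul_lt_iff₀ hNpos]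
  have hz := Complex.norm_le_abs_re_add_abs_im z
  have hr : |z.re| < (m + 1 : ℝ)⁻¹ * N := abs_lt.2 ⟨by linarith, e1⟩
  have hi : |z.im| < (m + 1 : ℝ)⁻¹ * N := abs_lt.2 ⟨by linarith, by linarith⟩
  rw [one_div] at hm
  have := mul_lt_mul_of_pos_right hm hNpos
  linarith

end Orbits

/-! ### Orthogonality to eigenvectors and averages of rank one operators -/

section Hilbert

open InnerProductSpace (rankOne)

variable {E : Type*} [NormedAddCommGroup E] [InnerProductSpace ℂ E]

theorem isCompactOperator_rankOne (x y : E) : IsCompactOperator (rankOne ℂ x y) := by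
  have h : IsCompactOperator (id : ℂ → ℂ) :=
    (isCompactOperator_id_iff_finiteDimensional (𝕜 := ℂ)).2 inferInstance
  exact (h.comp_clm (innerSL ℂ y)).clm_comp (ContinuousLinearMap.toSpanSingleton ℂ x)

/-- Here `c ≠ 0` by injectivity, so `⟨U h, U x⟩ = ⟨h, x⟩ = 0` can be divided by `conj c`. This
replaces the adjoint, and surjectivity of `U` is not needed. -/
theorem inner_isometry_eq_zero_of_inner_eq_zero (U : E →ₗᵢ[ℂ] E) {h x : E} {c : ℂ}
    (hh : U h = c • h) (hx : inner ℂ h x = 0) : inner ℂ h (U x) = 0 := by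
  by_cases h0 : h = 0
  · simp [h0]
  have hc : c ≠ 0 := by
    rintro rfl
    rw [zero_smul] at hh
    exact h0 (U.injective (hh.trans U.map_zero.symm))
  have := U.inner_map_map h x
  rw [hx, hh, inner_smul_left] at this
  exact (mul_eq_zero.1 this).resolve_left (by simpa using hc)

/-- A finite-dimensional subspace that is mapped into itself by an isometry is spanned by
eigenvectors. -/
theorem le_span_eigenvectors_of_finiteDimensional (U : E →ₗᵢ[ℂ] E) (V : Submodule ℂ E)
    [FiniteDimensional ℂ V] (hV : ∀ x ∈ V, U x ∈ V) :
    V ≤ Submodule.span ℂ {h | h ∈ V ∧ ∃ c : ℂ, U h = c • h} := by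
  set Z := Submodule.span ℂ {h | h ∈ V ∧ ∃ c : ℂ, U h = c • h}
  have hZV : Z ≤ V := Submodule.span_le.2 fun h hh => hh.1
  have : FiniteDimensional ℂ Z := Submodule.finiteDimensional_of_le hZV
  have hW : ∀ x ∈ Zᗮ ⊓ V, U x ∈ Zᗮ ⊓ V := by
    rintro x ⟨hx1, hx2⟩
    refine ⟨?_, hV x hx2⟩
    have : Z ≤ (ℂ ∙ U x)ᗮ := by
      refine Submodule.span_le.2 ?_
      rintro h ⟨hh, c, hc⟩
      rw [SetLike.mem_coe, Submodule.mem_orthogonal_singleton_iff_inner_left]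
      exact inner_isometry_eq_zero_of_inner_eq_zero U hc
        ((Submodule.mem_orthogonal _ _).1 hx1 h (Submodule.subset_span ⟨hh, c, hc⟩))
    exact (Submodule.mem_orthogonal _ _).2 fun z hz =>
      (Submodule.mem_orthogonal_singleton_iff_inner_left).1 (this hz)
  have hbot : Zᗮ ⊓ V = ⊥ := by
    by_contra hne
    have : Nontrivial (Zᗮ ⊓ V : Submodule ℂ E) := (Submodule.nontrivial_iff_ne_bot).2 hne
    have : FiniteDimensional ℂ (Zᗮ ⊓ V : Submodule ℂ E) :=
      Submodule.finiteDimensional_of_le inf_le_right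
    obtain ⟨c, hc⟩ := Module.End.exists_eigenvalue (U.toLinearMap.restrict hW)
    obtain ⟨w, hw⟩ := hc.exists_hasEigenvector
    have hwU : U w = c • (w : E) := congrArg Subtype.val hw.apply_eq_smul
    have hwZ : (w : E) ∈ Z := Submodule.subset_span ⟨w.2.2, c, hwU⟩
    have h0 := (Submodule.mem_orthogonal _ _).1 w.2.1 w hwZ
    exact hw.2 (Subtype.ext (inner_self_eq_zero.1 h0))
  have := Submodule.sup_orthogonal_inf_of_hasOrthogonalProjection hZV
  rw [hbot, sup_bot_eq] at this
  exact this.ge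

/-- The average of the rank one operators `⟨Uⁿf, ·⟩ Uⁿf` for `n < N`. -/
noncomputable def orbitAverage (U : E →ₗᵢ[ℂ] E) (f : E) (N : ℕ) : E →L[ℂ] E :=
  (N : ℂ)⁻¹ • ∑ n ∈ Finset.range N, rankOne ℂ (U^[n] f) (U^[n] f)

theorem orbitAverage_apply (U : E →ₗᵢ[ℂ] E) (f : E) (N : ℕ) (x : E) :
    orbitAverage U f N x =
      (N : ℂ)⁻¹ • ∑ n ∈ Finset.range N, inner ℂ (U^[n] f) x • U^[n] f := by
  simp [orbitAverage]

theorem isCompactOperator_orbitAverage (U : E →ₗᵢ[ℂ] E) (f : E) (N : ℕ) :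
    IsCompactOperator (orbitAverage U f N) := by
  have : orbitAverage U f N ∈ compactOperator (RingHom.id ℂ) E E :=
    Submodule.smul_mem _ _ (Submodule.sum_mem _ fun n _ => isCompactOperator_rankOne _ _)
  exact this

theorem isSymmetric_orbitAverage (U : E →ₗᵢ[ℂ] E) (f : E) (N : ℕ) (x y : E) :
    inner ℂ (orbitAverage U f N x) y = inner ℂ x (orbitAverage U f N y) := by
  simp only [orbitAverage_apply, inner_smul_left, inner_smul_right, sum_inner, inner_sum]
  simp [mul_comm]

/-- Conjugating by `U` shifts the index, so the difference telescopes to its two end terms. -/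
theorem norm_orbitAverage_commutator_le (U : E →ₗᵢ[ℂ] E) (f : E) (N : ℕ) (x : E) :
    ‖U (orbitAverage U f N x) - orbitAverage U f N (U x)‖ ≤ (N : ℝ)⁻¹ * (2 * (‖f‖ ^ 2 * ‖x‖)) := by
  have hnorm : ∀ n, ‖U^[n] f‖ = ‖f‖ := fun n => by
    induction n with
    | zero => rfl
    | succ n ih => rw [Function.iterate_succ_apply', U.norm_map, ih]
  have hterm : ∀ n, ‖inner ℂ (U^[n] f) (U x) • U^[n] f‖ ≤ ‖f‖ ^ 2 * ‖x‖ := fun n => by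
    rw [norm_smul, hnorm]
    have := norm_inner_le_norm (𝕜 := ℂ) (U^[n] f) (U x)
    rw [hnorm, U.norm_map] at this
    nlinarith [norm_nonneg f]
  have h1 : U (orbitAverage U f N x) = (N : ℂ)⁻¹ • ∑ n ∈ Finset.range N,
      inner ℂ (U^[n + 1] f) (U x) • U^[n + 1] f := by
    simp [orbitAverage_apply, map_sum, Function.iterate_succ_apply', U.inner_map_map]
  rw [h1, orbitAverage_apply, ← smul_sub, ← Finset.sum_sub_distrib,
    Finset.sum_range_sub (fun n => inner ℂ (U^[n] f) (U x) • U^[n] f), norm_smul, norm_inv,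
    Complex.norm_natCast]
  gcongr
  refine (norm_sub_le _ _).trans ?_
  linarith [hterm N, hterm 0]

variable [CompleteSpace E]

/-- A compact self-adjoint operator commuting with an isometry kills the vectors orthogonal to all
eigenvectors of the isometry. -/
theorem apply_eq_zero_of_orthogonal_eigenvectors (U : E →ₗᵢ[ℂ] E) {A : E →L[ℂ] E}
    (hA : IsCompactOperator A) (hA' : A.IsSymmetric) (hUA : ∀ x, A (U x) = U (A x)) {f : E}
    (hf : ∀ (h : E) (c : ℂ), U h = c • h → inner ℂ h f = 0) : A f = 0 := by
  have hmem : A f ∈ (⨆ c, Module.End.eigenspace (A : Module.End ℂ E) c)ᗮ := by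
    rw [← Submodule.iInf_orthogonal, Submodule.mem_iInf]
    intro c
    rw [Submodule.mem_orthogonal]
    intro v hv
    have hv' : A v = c • v := Module.End.mem_eigenspace_iff.1 hv
    have h1 : inner ℂ v (A f) = inner ℂ (A v) f := (hA' v f).symm
    rw [h1, hv', inner_smul_left]
    by_cases hc : c = 0
    · simp [hc]
    -- Compactness makes this eigenspace finite-dimensional and commutation makes it invariant, so
    -- eigenvectors of `U`, all orthogonal to `f`, span it.
    have := ContinuousLinearMap.finite_dimensional_eigenspace hA c hc
    have hle := le_span_eigenvectors_of_finiteDimensional U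
      (Module.End.eigenspace (A : Module.End ℂ E) c) (fun x hx => by
        have hx' : A x = c • x := Module.End.mem_eigenspace_iff.1 hx
        refine Module.End.mem_eigenspace_iff.2 ?_
        change A (U x) = c • U x
        rw [hUA, hx', map_smul])
    have hle2 : Submodule.span ℂ {h | h ∈ Module.End.eigenspace (A : Module.End ℂ E) c ∧
        ∃ c : ℂ, U h = c • h} ≤ (ℂ ∙ f)ᗮ := by
      refine Submodule.span_le.2 ?_
      rintro h ⟨-, d, hd⟩
      exact (Submodule.mem_orthogonal_singleton_iff_inner_left).2 (hf h d hd)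
    rw [(Submodule.mem_orthogonal_singleton_iff_inner_left).1 (hle2 (hle hv)), mul_zero]
  rwa [ContinuousLinearMap.orthogonalComplement_iSup_eigenspaces_eq_bot hA hA',
    Submodule.mem_bot] at hmem

/-- If the averages of `⟨Uⁿf, ·⟩ Uⁿf` converge and `f` is orthogonal to all eigenvectors, then the
limit kills `f`. -/
theorem limit_orbitAverage_apply_self (U : E →ₗᵢ[ℂ] E) {f : E} {A : E →L[ℂ] E}
    (hA : Tendsto (orbitAverage U f) atTop (𝓝 A))
    (hf : ∀ (h : E) (c : ℂ), U h = c • h → inner ℂ h f = 0) : A f = 0 := by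
  have happ : ∀ x, Tendsto (fun N => orbitAverage U f N x) atTop (𝓝 (A x)) := fun x =>
    (((ContinuousLinearMap.apply ℂ E x).continuous.tendsto A).comp hA)
  refine apply_eq_zero_of_orthogonal_eigenvectors U
    (isCompactOperator_of_tendsto hA (.of_forall (isCompactOperator_orbitAverage U f)))
    (fun x y => ?_) (fun x => ?_) hf
  · refine tendsto_nhds_unique ((happ x).inner tendsto_const_nhds) ?_
    simp_rw [isSymmetric_orbitAverage]
    exact tendsto_const_nhds.inner (happ y)
  · have h1 : Tendsto (fun N => U (orbitAverage U f N x) - orbitAverage U f N (U x)) atTop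
        (𝓝 (U (A x) - A (U x))) := ((U.continuous.tendsto _).comp (happ x)).sub (happ (U x))
    have h2 : Tendsto (fun N : ℕ => (N : ℝ)⁻¹ * (2 * (‖f‖ ^ 2 * ‖x‖))) atTop (𝓝 0) := by
      simpa using (tendsto_inv_atTop_nhds_zero_nat (𝕜 := ℝ)).mul_const (2 * (‖f‖ ^ 2 * ‖x‖))
    have h3 := squeeze_zero_norm (norm_orbitAverage_commutator_le U f · x) h2
    exact (sub_eq_zero.1 (tendsto_nhds_unique h1 h3)).symm

/-- The orbit averages of `f ⊗ f̄` under `U ⊗ Ū` tend to zero if `f` is orthogonal to all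
eigenvectors of `U`. The map `t` plays the role of `(x, y) ↦ x ⊗ ȳ`. -/
theorem tendsto_birkhoffAverage_tensor_zero {H : Type*} [NormedAddCommGroup H]
    [InnerProductSpace ℂ H] [CompleteSpace H] (U : E →ₗᵢ[ℂ] E) (U₂ : H →ₗᵢ[ℂ] H) (t : E → E → H)
    (ht : ∀ x y u v, inner ℂ (t x y) (t u v) = inner ℂ x u * inner ℂ v y)
    (htU : ∀ x y, U₂ (t x y) = t (U x) (U y)) {f : E}
    (hf : ∀ (h : E) (c : ℂ), U h = c • h → inner ℂ h f = 0) :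
    Tendsto (birkhoffAverage ℂ U₂ id · (t f f)) atTop (𝓝 0) := by
  have hiter : ∀ n, U₂^[n] (t f f) = t (U^[n] f) (U^[n] f) := fun n => by
    induction n with
    | zero => rfl
    | succ n ih => rw [Function.iterate_succ_apply', ih, htU, ← Function.iterate_succ_apply' U]
  have hinner : ∀ N x y, inner ℂ (t y x) (birkhoffAverage ℂ U₂ id N (t f f)) =
      inner ℂ y (orbitAverage U f N x) := by
    intro N x y
    simp only [birkhoffAverage, birkhoffSum, orbitAverage_apply, inner_smul_right, inner_sum,
      id, hiter, ht]
    simp [mul_comm]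
  have hnorm : ∀ x y, ‖t x y‖ = ‖x‖ * ‖y‖ := by
    intro x y
    have h := ht x y x y
    rw [inner_self_eq_norm_sq_to_K, inner_self_eq_norm_sq_to_K, inner_self_eq_norm_sq_to_K] at h
    have h' : ‖t x y‖ ^ 2 = (‖x‖ * ‖y‖) ^ 2 := by
      rw [mul_pow]
      exact_mod_cast h
    exact (pow_left_inj₀ (norm_nonneg _) (by positivity) two_ne_zero).1 h'
  -- The operator norm is at most the Hilbert–Schmidt norm, seen by testing the tensor against `t y
  -- x` with `y` the image of `x`. Hence mean ergodic convergence of the tensors yields norm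
  -- convergence of the operators.
  have hlip : ∀ M N, ‖orbitAverage U f M - orbitAverage U f N‖ ≤
      ‖birkhoffAverage ℂ U₂ id M (t f f) - birkhoffAverage ℂ U₂ id N (t f f)‖ := by
    intro M N
    refine ContinuousLinearMap.opNorm_le_bound _ (norm_nonneg _) fun x => ?_
    set y := (orbitAverage U f M - orbitAverage U f N) x with hy
    have h1 : inner ℂ (t y x)
        (birkhoffAverage ℂ U₂ id M (t f f) - birkhoffAverage ℂ U₂ id N (t f f)) =
        inner ℂ y y := by
      rw [inner_sub_right, hinner, hinner, ← inner_sub_right]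
      rfl
    have h2 := norm_inner_le_norm (𝕜 := ℂ) (t y x)
      (birkhoffAverage ℂ U₂ id M (t f f) - birkhoffAverage ℂ U₂ id N (t f f))
    rw [h1, hnorm, inner_self_eq_norm_sq_to_K, norm_pow] at h2
    simp only [RCLike.norm_ofReal, abs_norm] at h2
    by_cases hy0 : ‖y‖ = 0
    · rw [hy0]; positivity
    · have : 0 < ‖y‖ := lt_of_le_of_ne (norm_nonneg _) (Ne.symm hy0)
      nlinarith
  have hlim := U₂.toContinuousLinearMap.tendsto_birkhoffAverage_orthogonalProjection
    U₂.norm_toContinuousLinearMap_le (t f f)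
  set G := (U₂.toContinuousLinearMap.eqLocus
    (1 : H →L[ℂ] H)).orthogonalProjectionOnto (t f f) with hG
  change Tendsto (birkhoffAverage ℂ U₂ id · (t f f)) atTop (𝓝 (G : H)) at hlim
  have hcau : CauchySeq (orbitAverage U f) := by
    have := hlim.cauchySeq
    rw [Metric.cauchySeq_iff] at this ⊢
    intro ε hε
    obtain ⟨N, hN⟩ := this ε hε
    exact ⟨N, fun m hm n hn => by
      rw [dist_eq_norm]
      exact (hlip m n).trans_lt (by simpa [dist_eq_norm] using hN m hm n hn)⟩
  obtain ⟨A, hA⟩ := cauchySeq_tendsto_of_complete hcau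
  have hAf := limit_orbitAverage_apply_self U hA hf
  have h1 : Tendsto (fun N => inner ℂ (t f f) (birkhoffAverage ℂ U₂ id N (t f f))) atTop
      (𝓝 (inner ℂ (t f f) (G : H))) := tendsto_const_nhds.inner hlim
  have h2 : Tendsto (fun N => inner ℂ (t f f) (birkhoffAverage ℂ U₂ id N (t f f))) atTop
      (𝓝 (inner ℂ f (A f))) := by
    simp_rw [hinner]
    exact tendsto_const_nhds.inner (((ContinuousLinearMap.apply ℂ E f).continuous.tendsto A).comp hA)
  have h3 := tendsto_nhds_unique h1 h2
  rw [hAf, inner_zero_right] at h3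
  -- `G` is the orthogonal projection of `t f f`, so `⟨G, G⟩ = ⟨t f f, G⟩`, and the latter equals
  -- `⟨f, A f⟩ = 0`.
  have h4 : inner ℂ (G : H) (G : H) = (0 : ℂ) := by
    exact (Submodule.inner_orthogonalProjectionOnto_eq_of_mem_right G (t f f)).trans h3
  rwa [inner_self_eq_zero.1 h4] at hlim

end Hilbert

/-! ### From convergence in mean to convergence almost everywhere -/

section Averages

variable {Ω : Type*} [MeasurableSpace Ω] {P : Measure Ω} {R : Ω → Ω}

theorem iterate_compMeasurePreserving_toLp (hR : MeasurePreserving R P P) {F : Ω → ℂ}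
    (hF : MemLp F 2 P) (n : ℕ) :
    (Lp.compMeasurePreservingₗᵢ ℂ R hR)^[n] (hF.toLp F) =
      (hF.comp_measurePreserving (hR.iterate n)).toLp (F ∘ R^[n]) := by
  induction n with
  | zero => rfl
  | succ n ih => rw [Function.iterate_succ_apply', ih]; rfl

theorem coeFn_birkhoffAverage_toLp (hR : MeasurePreserving R P P) {F : Ω → ℂ}
    (hF : MemLp F 2 P) (N : ℕ) :
    (birkhoffAverage ℂ (Lp.compMeasurePreservingₗᵢ ℂ R hR) id N (hF.toLp F) : Lp ℂ 2 P) =ᵐ[P]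
      fun ω => (N : ℂ)⁻¹ * ∑ n ∈ Finset.range N, F (R^[n] ω) := by
  have hsum : ∀ N, (((∑ n ∈ Finset.range N,
      (Lp.compMeasurePreservingₗᵢ ℂ R hR)^[n] (hF.toLp F) : Lp ℂ 2 P)) : Ω → ℂ) =ᵐ[P]
      fun ω => ∑ n ∈ Finset.range N, F (R^[n] ω) := by
    intro N
    induction N with
    | zero =>
      simp only [Finset.range_zero, Finset.sum_empty]
      exact Lp.coeFn_zero ℂ 2 P
    | succ N ih =>
      rw [Finset.sum_range_succ, iterate_compMeasurePreserving_toLp]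
      filter_upwards [Lp.coeFn_add (∑ n ∈ Finset.range N,
        (Lp.compMeasurePreservingₗᵢ ℂ R hR)^[n] (hF.toLp F))
        ((hF.comp_measurePreserving (hR.iterate N)).toLp (F ∘ R^[N])), ih,
        (hF.comp_measurePreserving (hR.iterate N)).coeFn_toLp] with ω h1 h2 h3
      rw [h1, Pi.add_apply, h2, h3, Finset.sum_range_succ]
      rfl
  simp only [birkhoffAverage, birkhoffSum, id]
  filter_upwards [Lp.coeFn_smul (N : ℂ)⁻¹ (∑ n ∈ Finset.range N,
      (Lp.compMeasurePreservingₗᵢ ℂ R hR)^[n] (hF.toLp F)), hsum N] with ω h1 h2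
  rw [h1, Pi.smul_apply, h2, smul_eq_mul]

theorem tendsto_integral_norm_average_zero [IsProbabilityMeasure P]
    (hR : MeasurePreserving R P P) {F : Ω → ℂ} (hF : MemLp F 2 P)
    (h : Tendsto (birkhoffAverage ℂ (Lp.compMeasurePreservingₗᵢ ℂ R hR) id · (hF.toLp F))
      atTop (𝓝 0)) :
    Tendsto (fun N : ℕ => ∫ ω, ‖(N : ℂ)⁻¹ * ∑ n ∈ Finset.range N, F (R^[n] ω)‖ ∂P)
      atTop (𝓝 0) := by
  refine squeeze_zero (fun N => integral_nonneg fun _ => norm_nonneg _) (fun N => ?_)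
    (tendsto_zero_iff_norm_tendsto_zero.1 h)
  set G := birkhoffAverage ℂ (Lp.compMeasurePreservingₗᵢ ℂ R hR) id N (hF.toLp F)
  have h1 : ∫ ω, ‖(N : ℂ)⁻¹ * ∑ n ∈ Finset.range N, F (R^[n] ω)‖ ∂P = ∫ ω, ‖G ω‖ ∂P :=
    integral_congr_ae ((coeFn_birkhoffAverage_toLp hR hF N).mono fun ω hω =>
      congrArg norm hω.symm)
  rw [h1, integral_norm_eq_lintegral_enorm (Lp.aestronglyMeasurable G), Lp.norm_def,
    ← eLpNorm_one_eq_lintegral_enorm]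
  exact ENNReal.toReal_mono (Lp.eLpNorm_ne_top G)
    (eLpNorm_le_eLpNorm_of_exponent_le (by norm_num) (Lp.aestronglyMeasurable G))

-- The covering step of the maximal inequality: greedy packing with `a = 1` and `V = 0`. The range
-- is lengthened to `J + M` so that windows starting below `J` fit.
open Classical in
theorem card_mul_le_sum_of_forall_exists_window {b : ℕ → ℝ} (hb : ∀ n, 0 ≤ b n) {ε : ℝ}
    (hε : 0 ≤ ε) {M : ℕ} (E : Set ℕ)
    (hE : ∀ n ∈ E, ∃ l, 1 ≤ l ∧ l ≤ M ∧ ε * l ≤ ∑ k ∈ Finset.range l, b (n + k)) (J : ℕ) :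
    ε * ((Finset.range J).filter fun n => n ∈ E).card ≤ ∑ n ∈ Finset.range (J + M), b n := by
  obtain ⟨E', hE'⟩ : ∃ E' : Set ℕ, ∀ n, n ∈ E' ↔ n ∈ E ∧ n < J := ⟨{n | _}, fun _ => Iff.rfl⟩
  obtain ⟨c, -, hc1, hc2, -⟩ := exists_block_packing (a := fun _ => 1) (b := fun n => (b n : ℂ))
    (V := fun _ => 0) (η := 0) (δ := 0) (L₀ := 0) (L := 1) (J := J + M) (by simp) hε le_rfl le_rfl
    one_pos E' (by
      intro n hn'
      obtain ⟨hn, hnJ⟩ := (hE' n).1 hn'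
      obtain ⟨l, h1, h2, h3⟩ := hE n hn
      exact ⟨l, h1, by omega, by simpa [← Complex.ofReal_sum] using h3, by simp⟩) (J + M) 0 (by simp)
  rw [← Finset.range_eq_Ico] at hc2
  have hcard : ((Finset.range J).filter fun n => n ∈ E).card ≤
      ((Finset.range (J + M)).filter fun n => n ∈ E').card := by
    refine Finset.card_le_card fun n hn => ?_
    simp only [Finset.mem_filter, Finset.mem_range, hE'] at hn ⊢
    exact ⟨by omega, hn.2, hn.1⟩
  refine (mul_le_mul_of_nonneg_left (Nat.cast_le.2 hcard) hε).trans (hc2.trans ?_)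
  refine (Complex.re_le_norm _).trans ((norm_sum_le _ _).trans (Finset.sum_le_sum fun n _ => ?_))
  rw [norm_mul, Complex.norm_real, Real.norm_of_nonneg (hb n)]
  exact mul_le_of_le_one_left (hb n) (hc1 n)

/-- The maximal ergodic inequality. -/
theorem mul_measureReal_frequently_le_integral [IsProbabilityMeasure P]
    (hR : MeasurePreserving R P P) {h : Ω → ℝ} (hm : Measurable h) (h0 : ∀ ω, 0 ≤ h ω)
    (hi : Integrable h P) {ε : ℝ} (hε : 0 < ε) :
    ε * P.real {ω | ∃ᶠ n : ℕ in atTop, ε * n ≤ ∑ k ∈ Finset.range n, h (R^[k] ω)} ≤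
      ∫ ω, h ω ∂P := by
  classical
  let s : ℕ → Set Ω := fun n => {ω | ε * n ≤ ∑ k ∈ Finset.range n, h (R^[k] ω)}
  have hs : ∀ N, MeasurableSet (s N) := fun N =>
    measurableSet_le measurable_const
      (Finset.measurable_fun_sum _ fun k _ => hm.comp (hR.measurable.iterate k))
  have key : ∀ M, ε * P.real {ω | ∃ l, 1 ≤ l ∧ l ≤ M ∧ ω ∈ s l} ≤ ∫ ω, h ω ∂P := by
    intro M
    set B := {ω | ∃ l, 1 ≤ l ∧ l ≤ M ∧ ω ∈ s l} with hBdef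
    have hB : MeasurableSet B := by
      have : B = ⋃ l ∈ Finset.Icc 1 M, s l := by
        ext; simp [hBdef, and_assoc]
      rw [this]
      exact Finset.measurableSet_biUnion _ fun l _ => hs l
    -- Integrating the covering bound along orbits of length `J` costs only a factor `(J + M) / J`,
    -- which tends to `1`.
    have hJ : ∀ J : ℕ, ε * (J * P.real B) ≤ (J + M) * ∫ ω, h ω ∂P := by
      intro J
      have hBm : ∀ n, MeasurableSet (R^[n] ⁻¹' B) := fun n => (hR.iterate n).measurable hB
      have hBi : ∀ n, Integrable ((R^[n] ⁻¹' B).indicator (1 : Ω → ℝ)) P := fun n =>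
        (integrable_const (1 : ℝ)).indicator (hBm n)
      have hhi : ∀ n, Integrable (fun ω => h (R^[n] ω)) P := fun n =>
        (hR.iterate n).integrable_comp_of_integrable hi
      have hle : ∫ ω, ε * ∑ n ∈ Finset.range J, (R^[n] ⁻¹' B).indicator (1 : Ω → ℝ) ω ∂P ≤
          ∫ ω, ∑ n ∈ Finset.range (J + M), h (R^[n] ω) ∂P := by
        refine integral_mono ((integrable_finsetSum _ fun n _ => hBi n).const_mul _)
          (integrable_finsetSum _ fun n _ => hhi n) fun ω => ?_
        refine le_trans (le_of_eq ?_) (card_mul_le_sum_of_forall_exists_window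
          (b := fun n => h (R^[n] ω)) (fun n => h0 _) hε.le (M := M) {n | R^[n] ω ∈ B} ?_ J)
        · congr 1
          rw [Finset.card_filter]
          push_cast
          refine Finset.sum_congr rfl fun n _ => ?_
          simp [Set.indicator_apply]
        · rintro n ⟨l, h1, h2, h3⟩
          refine ⟨l, h1, h2, ?_⟩
          simpa only [s, Set.mem_ofPred_eq, ← Function.iterate_add_apply, add_comm] using h3
      rw [integral_const_mul, integral_finsetSum _ fun n _ => hBi n,
        integral_finsetSum _ fun n _ => hhi n] at hle
      have e1 : ∀ n, ∫ ω, (R^[n] ⁻¹' B).indicator (1 : Ω → ℝ) ω ∂P = P.real B := fun n => by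
        rw [integral_indicator_one (hBm n),
          (hR.iterate n).measureReal_preimage hB.nullMeasurableSet]
      have e2 : ∀ n, ∫ ω, h (R^[n] ω) ∂P = ∫ ω, h ω ∂P := fun n => by
        conv_rhs => rw [← (hR.iterate n).map_eq]
        rw [integral_map (hR.iterate n).measurable.aemeasurable hm.aestronglyMeasurable]
      simpa [e1, e2] using hle
    have ht : Tendsto (fun J : ℕ => (1 + M / (J : ℝ)) * ∫ ω, h ω ∂P) atTop
        (𝓝 ((1 + 0) * ∫ ω, h ω ∂P)) :=
      ((tendsto_const_div_atTop_nhds_zero_nat (M : ℝ)).const_add 1).mul_const _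
    rw [add_zero, one_mul] at ht
    refine ge_of_tendsto ht ?_
    filter_upwards [eventually_gt_atTop 0] with J hJ0
    have hJ0' : (0 : ℝ) < J := by exact_mod_cast hJ0
    have := hJ J
    rw [one_add_div hJ0'.ne', div_mul_eq_mul_div, le_div_iff₀ hJ0']
    linarith
  refine le_of_forall_pos_le_add fun η hη => ?_
  obtain ⟨M, -, hM⟩ := exists_le_measureReal_iUnion_of_frequently (ν := P) (s := s)
    (β := P.real {ω | ∃ᶠ n in atTop, ω ∈ s n} - η / ε) (sub_lt_self _ (by positivity)) 1
  have h2 := (mul_le_mul_of_nonneg_left hM hε.le).trans (key M)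
  rw [mul_sub, mul_div_cancel₀ _ hε.ne'] at h2
  have h3 : {ω | ∃ᶠ n : ℕ in atTop, ε * n ≤ ∑ k ∈ Finset.range n, h (R^[k] ω)} =
    {ω | ∃ᶠ n in atTop, ω ∈ s n} := rfl
  rw [h3]
  linarith

theorem norm_sum_shift_sub_le {s : ℕ → ℂ} {C : ℝ} (hs : ∀ n, ‖s n‖ ≤ C) (n j : ℕ) :
    ‖∑ k ∈ Finset.range n, s (k + j) - ∑ k ∈ Finset.range n, s k‖ ≤ 2 * C * j := by
  induction j with
  | zero => simp
  | succ j ih =>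
    have h1 : ∑ k ∈ Finset.range n, s (k + (j + 1)) =
        ∑ k ∈ Finset.range n, s (k + j) + (s (n + j) - s j) := by
      have h := Finset.sum_range_sub (fun k => s (k + j)) n
      rw [Finset.sum_sub_distrib, zero_add] at h
      rw [← h]
      simp only [add_right_comm, ← add_assoc]
      ring
    have h2 : ∑ k ∈ Finset.range n, s (k + (j + 1)) - ∑ k ∈ Finset.range n, s k =
        (∑ k ∈ Finset.range n, s (k + j) - ∑ k ∈ Finset.range n, s k) + (s (n + j) - s j) := by
      rw [h1]; ring
    rw [h2]
    refine (norm_add_le _ _).trans ?_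
    have h3 := (norm_sub_le (s (n + j)) (s j)).trans (add_le_add (hs _) (hs _))
    push_cast
    linarith

/-- Averaging over `N` shifts alters a long sum only by boundary terms. The maximal inequality can
therefore be applied to the `N`-averages, whose mean is small, instead of to `F`. -/
theorem norm_sum_le_sum_norm_average_add {s : ℕ → ℂ} {C : ℝ} (hs : ∀ n, ‖s n‖ ≤ C) {N : ℕ}
    (hN : 0 < N) (n : ℕ) :
    ‖∑ k ∈ Finset.range n, s k‖ ≤
      ∑ k ∈ Finset.range n, ‖(N : ℂ)⁻¹ * ∑ j ∈ Finset.range N, s (k + j)‖ + 2 * C * N := by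
  have hC : 0 ≤ C := (norm_nonneg _).trans (hs 0)
  have hN' : (N : ℂ) ≠ 0 := by exact_mod_cast hN.ne'
  have hNr : (N : ℝ) ≠ 0 := by exact_mod_cast hN.ne'
  have h1 : ∑ k ∈ Finset.range n, (N : ℂ)⁻¹ * ∑ j ∈ Finset.range N, s (k + j) -
      ∑ k ∈ Finset.range n, s k = (N : ℂ)⁻¹ * ∑ j ∈ Finset.range N,
        (∑ k ∈ Finset.range n, s (k + j) - ∑ k ∈ Finset.range n, s k) := by
    rw [← Finset.mul_sum, Finset.sum_comm, Finset.sum_sub_distrib, mul_sub]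
    simp [hN']
  have h2 : ‖∑ k ∈ Finset.range n, (N : ℂ)⁻¹ * ∑ j ∈ Finset.range N, s (k + j) -
      ∑ k ∈ Finset.range n, s k‖ ≤ 2 * C * N := by
    rw [h1, norm_mul, norm_inv, Complex.norm_natCast]
    have h3 : ‖∑ j ∈ Finset.range N,
        (∑ k ∈ Finset.range n, s (k + j) - ∑ k ∈ Finset.range n, s k)‖ ≤ N * (2 * C * N) := by
      refine (norm_sum_le _ _).trans ((Finset.sum_le_card_nsmul _ _ (2 * C * N) fun j hj => ?_).trans
        (by simp))
      refine (norm_sum_shift_sub_le hs n j).trans ?_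
      have : (j : ℝ) ≤ N := by exact_mod_cast (Finset.mem_range.1 hj).le
      gcongr
    refine (mul_le_mul_of_nonneg_left h3 (by positivity)).trans (le_of_eq ?_)
    field_simp
  have h4 := norm_sub_norm_le (∑ k ∈ Finset.range n, s k)
    (∑ k ∈ Finset.range n, (N : ℂ)⁻¹ * ∑ j ∈ Finset.range N, s (k + j))
  rw [norm_sub_rev] at h4
  have h5 := norm_sum_le (Finset.range n) fun k => (N : ℂ)⁻¹ * ∑ j ∈ Finset.range N, s (k + j)
  linarith

/-- Bounded functions whose ergodic averages tend to zero in mean have ergodic averages that tend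
to zero almost everywhere. -/
theorem ae_tendsto_average_zero [IsProbabilityMeasure P] (hR : MeasurePreserving R P P)
    {F : Ω → ℂ} (hF : Measurable F) {C : ℝ} (hC : ∀ ω, ‖F ω‖ ≤ C)
    (h : Tendsto (fun N : ℕ => ∫ ω, ‖(N : ℂ)⁻¹ * ∑ n ∈ Finset.range N, F (R^[n] ω)‖ ∂P)
      atTop (𝓝 0)) :
    ∀ᵐ ω ∂P, Tendsto (fun N : ℕ => (N : ℂ)⁻¹ * ∑ n ∈ Finset.range N, F (R^[n] ω)) atTop
      (𝓝 0) := by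
  have key : ∀ m : ℕ, ∀ᵐ ω ∂P, ∀ᶠ n : ℕ in atTop,
      ‖∑ k ∈ Finset.range n, F (R^[k] ω)‖ < 1 / (m + 1) * n := by
    intro m
    set ε : ℝ := 1 / (m + 1)
    have hε : 0 < ε := by positivity
    set D := {ω | ∃ᶠ n : ℕ in atTop, ε * n ≤ ‖∑ k ∈ Finset.range n, F (R^[k] ω)‖}
    have hD : ∀ N : ℕ, 0 < N → ε / 2 * P.real D ≤
        ∫ ω, ‖(N : ℂ)⁻¹ * ∑ n ∈ Finset.range N, F (R^[n] ω)‖ ∂P := by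
      intro N hN
      have hm : Measurable fun ω => ‖(N : ℂ)⁻¹ * ∑ n ∈ Finset.range N, F (R^[n] ω)‖ :=
        ((Finset.measurable_fun_sum _ fun k _ => hF.comp (hR.measurable.iterate k)).const_mul
          _).norm
      have hNr : (N : ℝ) ≠ 0 := by exact_mod_cast hN.ne'
      have hb : ∀ ω, ‖(N : ℂ)⁻¹ * ∑ n ∈ Finset.range N, F (R^[n] ω)‖ ≤ C := by
        intro ω
        rw [norm_mul, norm_inv, Complex.norm_natCast]
        have h1 := (norm_sum_le (Finset.range N) fun n => F (R^[n] ω)).trans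
          (Finset.sum_le_card_nsmul _ _ C fun n _ => hC _)
        rw [Finset.card_range, nsmul_eq_mul] at h1
        refine (mul_le_mul_of_nonneg_left h1 (by positivity)).trans (le_of_eq ?_)
        field_simp
      have hi : Integrable (fun ω => ‖(N : ℂ)⁻¹ * ∑ n ∈ Finset.range N, F (R^[n] ω)‖) P :=
        Integrable.of_bound hm.aestronglyMeasurable C (.of_forall fun ω => by
          rw [norm_norm]; exact hb ω)
      refine le_trans (mul_le_mul_of_nonneg_left (measureReal_mono fun ω hω => ?_) (by positivity))
        (mul_measureReal_frequently_le_integral hR hm (fun _ => norm_nonneg _) hi (half_pos hε))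
      -- Beyond `t` the boundary error `2 * C * N` is at most `ε / 2 * n`; the other half of `ε` is
      -- left for the `N`-averages.
      obtain ⟨t, ht⟩ := exists_nat_ge (2 * C * N / (ε / 2))
      rw [div_le_iff₀ (by positivity)] at ht
      refine (Frequently.and_eventually hω (eventually_ge_atTop t)).mono fun n hn => ?_
      have h1 := norm_sum_le_sum_norm_average_add (s := fun k => F (R^[k] ω)) (fun n => hC _) hN n
      have h2 : (t : ℝ) ≤ n := by exact_mod_cast hn.2
      have h3 := hn.1
      have h4 : (t : ℝ) * (ε / 2) ≤ n * (ε / 2) := by gcongr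
      simp only [← Function.iterate_add_apply, add_comm] at h1 ⊢
      linarith
    have h0 : ε / 2 * P.real D ≤ 0 :=
      ge_of_tendsto h ((eventually_gt_atTop 0).mono hD)
    have h1 : P.real D = 0 := le_antisymm (by nlinarith) measureReal_nonneg
    rw [ae_iff]
    rw [measureReal_eq_zero_iff] at h1
    simp only [not_eventually, not_lt]
    exact h1
  filter_upwards [ae_all_iff.2 key] with ω hω
  rw [Metric.tendsto_atTop']
  intro ε hε
  obtain ⟨m, hm⟩ := exists_nat_one_div_lt hε
  obtain ⟨N₀, hN₀⟩ := eventually_atTop.1 ((hω m).and (eventually_gt_atTop 0))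
  refine ⟨N₀, fun N hN => ?_⟩
  obtain ⟨h1, h2⟩ := hN₀ N hN.le
  have hNpos : (0 : ℝ) < N := by exact_mod_cast h2
  rw [dist_zero_right, norm_mul, norm_inv, Complex.norm_natCast, inv_mul_lt_iff₀ hNpos]
  have := mul_lt_mul_of_pos_right hm hNpos
  linarith

end Averages

/-! ### Visit frequencies in an ergodic system -/

theorem tendsto_birkhoffAverage_zero_of_orthogonal_fixed {H : Type*} [NormedAddCommGroup H]
    [InnerProductSpace ℂ H] [CompleteSpace H] (U : H →ₗᵢ[ℂ] H) {v : H}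
    (hv : ∀ w, U w = w → inner ℂ v w = 0) :
    Tendsto (birkhoffAverage ℂ U id · v) atTop (𝓝 0) := by
  have hlim := U.toContinuousLinearMap.tendsto_birkhoffAverage_orthogonalProjection
    U.norm_toContinuousLinearMap_le v
  have h0 : (U.toContinuousLinearMap.eqLocus (1 : H →L[ℂ] H)).orthogonalProjectionOnto v = 0 := by
    rw [Submodule.orthogonalProjectionOnto_eq_zero_iff, Submodule.mem_orthogonal']
    exact fun w hw => hv w hw
  rwa [h0] at hlim

section Ergodic

variable {X : Type*} [MeasurableSpace X] {μ : Measure X} [IsProbabilityMeasure μ] {T : X → X}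

-- The centred indicator of `B` is orthogonal to the invariant functions, which are constant by
-- ergodicity. Its averages thus vanish in mean and, being bounded, almost everywhere.
open Classical in
theorem ae_tendsto_visit_frequency (hT : Ergodic T μ) {B : Set X} (hB : MeasurableSet B) :
    ∀ᵐ x ∂μ, Tendsto (fun N : ℕ =>
      (((Finset.range N).filter fun n => T^[n] x ∈ B).card : ℝ) / N) atTop (𝓝 (μ.real B)) := by
  set F : X → ℂ := fun x => B.indicator (1 : X → ℂ) x - μ.real B with hFdef
  have hFm : Measurable F := (measurable_one.indicator hB).sub measurable_const
  have hFb : ∀ x, ‖F x‖ ≤ 2 := fun x => by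
    refine (norm_sub_le _ _).trans ?_
    have h1 : ‖B.indicator (1 : X → ℂ) x‖ ≤ 1 := by
      by_cases hx : x ∈ B <;> simp [hx]
    have h2 : ‖((μ.real B : ℝ) : ℂ)‖ ≤ 1 := by
      rw [Complex.norm_real, Real.norm_of_nonneg measureReal_nonneg]
      exact measureReal_le_one
    linarith
  have hF2 : MemLp F 2 μ := MemLp.of_bound hFm.aestronglyMeasurable 2 (.of_forall hFb)
  have hFint : ∫ x, F x ∂μ = 0 := by
    have hi : Integrable (B.indicator (1 : X → ℂ)) μ := (integrable_const (1 : ℂ)).indicator hB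
    simp only [hFdef]
    rw [integral_sub hi (integrable_const _)]
    have : ∫ x, B.indicator (1 : X → ℂ) x ∂μ = μ.real B := by
      rw [integral_indicator hB]
      simp
    rw [this]
    simp
  have hL2 := tendsto_birkhoffAverage_zero_of_orthogonal_fixed
    (Lp.compMeasurePreservingₗᵢ ℂ T hT.toMeasurePreserving) (v := hF2.toLp F) (fun w hw => by
      have hw' : (w : X → ℂ) ∘ T =ᵐ[μ] w := by
        refine (Lp.coeFn_compMeasurePreserving w hT.toMeasurePreserving).symm.trans ?_
        change (Lp.compMeasurePreservingₗᵢ ℂ T hT.toMeasurePreserving w : X → ℂ) =ᵐ[μ] w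
        rw [hw]
      obtain ⟨c, hc⟩ := hT.ae_eq_const_of_ae_eq_comp_ae (Lp.aestronglyMeasurable w) hw'
      rw [L2.inner_def]
      have : ∫ x, inner ℂ (hF2.toLp F x) (w x) ∂μ = ∫ x, c * conj (F x) ∂μ := by
        refine integral_congr_ae ?_
        filter_upwards [hF2.coeFn_toLp, hc] with x h1 h2
        rw [h1, h2, RCLike.inner_apply]
        rfl
      rw [this, integral_const_mul, integral_conj, hFint]
      simp)
  filter_upwards [ae_tendsto_average_zero hT.toMeasurePreserving hFm hFb
    (tendsto_integral_norm_average_zero hT.toMeasurePreserving hF2 hL2)] with x hx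
  have h2 := (Complex.continuous_re.tendsto _).comp hx
  have h3 := h2.add_const (μ.real B)
  rw [Complex.zero_re, zero_add] at h3
  refine h3.congr' ?_
  filter_upwards [eventually_gt_atTop 0] with N hN
  have hN' : (N : ℝ) ≠ 0 := by exact_mod_cast hN.ne'
  have h4 : ∑ n ∈ Finset.range N, F (T^[n] x) =
      (((((Finset.range N).filter fun n => T^[n] x ∈ B).card : ℝ) - N * μ.real B : ℝ) : ℂ) := by
    simp only [hFdef, Finset.sum_sub_distrib, Finset.card_filter]
    simp [Set.indicator_apply]
  simp only [Function.comp, h4]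
  rw [show ((N : ℂ)⁻¹) = (((N : ℝ)⁻¹ : ℝ) : ℂ) by push_cast; rfl, ← Complex.ofReal_mul,
    Complex.ofReal_re]
  field_simp
  ring

end Ergodic

/-! ### Decorrelation of almost every pair of orbits -/

section Tensor

variable {X : Type*} [MeasurableSpace X] {μ : Measure X} {T : X → X}

theorem memLp_conjTensor (x y : Lp ℂ 2 μ) :
    MemLp (fun z : X × X => x z.1 * conj (y z.2)) 2 (μ.prod μ) := by
  have h1 : AEStronglyMeasurable (fun z : X × X => x z.1 * conj (y z.2)) (μ.prod μ) :=
    (Lp.aestronglyMeasurable x).comp_fst.mul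
      (Complex.continuous_conj.comp_aestronglyMeasurable (Lp.aestronglyMeasurable y).comp_snd)
  rw [memLp_two_iff_integrable_sq_norm h1]
  have h2 := ((memLp_two_iff_integrable_sq_norm (Lp.aestronglyMeasurable x)).1 (Lp.memLp x)).mul_prod
    ((memLp_two_iff_integrable_sq_norm (Lp.aestronglyMeasurable y)).1 (Lp.memLp y))
  refine h2.congr (.of_forall fun z => ?_)
  simp [mul_pow]

/-- The function `(s, t) ↦ x(s) * conj y(t)` in `L²(μ × μ)`. -/
noncomputable def conjTensor (x y : Lp ℂ 2 μ) : Lp ℂ 2 (μ.prod μ) :=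
  (memLp_conjTensor x y).toLp _

theorem inner_conjTensor [SFinite μ] (x y u v : Lp ℂ 2 μ) :
    inner ℂ (conjTensor x y) (conjTensor u v) = inner ℂ x u * inner ℂ v y := by
  rw [L2.inner_def, L2.inner_def, L2.inner_def, ← integral_prod_mul]
  refine integral_congr_ae ?_
  filter_upwards [(memLp_conjTensor x y).coeFn_toLp, (memLp_conjTensor u v).coeFn_toLp]
    with z h1 h2
  rw [conjTensor, conjTensor, h1, h2]
  simp only [RCLike.inner_apply, map_mul, Complex.conj_conj]
  ring

theorem compMeasurePreserving_conjTensor [SFinite μ] (hT : MeasurePreserving T μ μ) (x y : Lp ℂ 2 μ) :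
    Lp.compMeasurePreservingₗᵢ ℂ (Prod.map T T) (hT.prod hT) (conjTensor x y) =
      conjTensor (Lp.compMeasurePreservingₗᵢ ℂ T hT x) (Lp.compMeasurePreservingₗᵢ ℂ T hT y) := by
  refine Lp.ext ?_
  have h1 : (Lp.compMeasurePreservingₗᵢ ℂ (Prod.map T T) (hT.prod hT) (conjTensor x y) :
      X × X → ℂ) =ᵐ[μ.prod μ] conjTensor x y ∘ Prod.map T T :=
    Lp.coeFn_compMeasurePreserving _ (hT.prod hT)
  have h2 : ∀ w : Lp ℂ 2 μ, (Lp.compMeasurePreservingₗᵢ ℂ T hT w : X → ℂ) =ᵐ[μ] w ∘ T :=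
    fun w => Lp.coeFn_compMeasurePreserving _ hT
  filter_upwards [h1, (hT.prod hT).quasiMeasurePreserving.ae (memLp_conjTensor x y).coeFn_toLp,
    (memLp_conjTensor (Lp.compMeasurePreservingₗᵢ ℂ T hT x)
      (Lp.compMeasurePreservingₗᵢ ℂ T hT y)).coeFn_toLp,
    Measure.quasiMeasurePreserving_fst.ae (h2 x), Measure.quasiMeasurePreserving_snd.ae (h2 y)]
    with z e1 e2 e3 e4 e5
  rw [e1, Function.comp_apply, conjTensor, e2, conjTensor, e3, e4, e5]
  rfl

/-- If `f` is orthogonal to the Kronecker factor, then for almost every pair of points the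
correlation of the two orbits under `f` vanishes. -/
theorem ae_ae_tendsto_correlation_zero [IsProbabilityMeasure μ] (hT : MeasurePreserving T μ μ)
    {f : X → ℂ}
    (hf : Measurable f) (hf1 : ∀ x, ‖f x‖ ≤ 1) (hf2 : MemLp f 2 μ)
    (hfK : hf2.toLp f ∈ (kroneckerFactor hT)ᗮ) :
    ∀ᵐ x ∂μ, ∀ᵐ ξ ∂μ, Tendsto (fun N : ℕ =>
      (N : ℂ)⁻¹ * ∑ n ∈ Finset.range N, f (T^[n] x) * conj (f (T^[n] ξ))) atTop (𝓝 0) := by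
  have hort : ∀ (h : Lp ℂ 2 μ) (c : ℂ), Lp.compMeasurePreservingₗᵢ ℂ T hT h = c • h →
      inner ℂ h (hf2.toLp f) = 0 := by
    intro h c hc
    by_cases h0 : h = 0
    · simp [h0]
    refine (Submodule.mem_orthogonal _ _).1 hfK h
      (Submodule.le_topologicalClosure _ (Submodule.subset_span ⟨c, ?_, h0⟩))
    exact Module.End.mem_eigenspace_iff.2 hc
  have ht := tendsto_birkhoffAverage_tensor_zero (Lp.compMeasurePreservingₗᵢ ℂ T hT)
    (Lp.compMeasurePreservingₗᵢ ℂ (Prod.map T T) (hT.prod hT)) conjTensor inner_conjTensor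
    (compMeasurePreserving_conjTensor hT) hort
  set F : X × X → ℂ := fun z => f z.1 * conj (f z.2)
  have hFm : Measurable F := (hf.comp measurable_fst).mul
    (Complex.continuous_conj.measurable.comp (hf.comp measurable_snd))
  have hFb : ∀ z, ‖F z‖ ≤ 1 := fun z => by
    simp only [F, norm_mul, RCLike.norm_conj]
    exact mul_le_one₀ (hf1 _) (norm_nonneg _) (hf1 _)
  have hF2 : MemLp F 2 (μ.prod μ) := MemLp.of_bound hFm.aestronglyMeasurable 1 (.of_forall hFb)
  have hFt : conjTensor (hf2.toLp f) (hf2.toLp f) = hF2.toLp F := by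
    refine Lp.ext ?_
    filter_upwards [(memLp_conjTensor (hf2.toLp f) (hf2.toLp f)).coeFn_toLp, hF2.coeFn_toLp,
      Measure.quasiMeasurePreserving_fst.ae hf2.coeFn_toLp,
      Measure.quasiMeasurePreserving_snd.ae hf2.coeFn_toLp] with z e1 e2 e3 e4
    rw [conjTensor, e1, e2, e3, e4]
  rw [hFt] at ht
  have h := ae_tendsto_average_zero (hT.prod hT) hFm hFb
    (tendsto_integral_norm_average_zero (hT.prod hT) hF2 ht)
  filter_upwards [Measure.ae_ae_of_ae_prod h] with x hx
  filter_upwards [hx] with ξ hξ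
  simpa [F, Prod.map_iterate] using hξ

end Tensor

/-! ### Quantized patterns and self-uncorrelated orbits -/

theorem norm_sum_mul_conj_sub_le {a u v : ℕ → ℂ} (ha : ∀ k, ‖a k‖ ≤ 1) {η : ℝ} {l : ℕ}
    (huv : ∀ k < l, ‖u k - v k‖ ≤ η) :
    ‖∑ k ∈ Finset.range l, a k * conj (u k)‖ ≤
      ‖∑ k ∈ Finset.range l, a k * conj (v k)‖ + η * l := by
  have h1 : ∑ k ∈ Finset.range l, a k * conj (u k) =
      ∑ k ∈ Finset.range l, a k * conj (v k) +
        ∑ k ∈ Finset.range l, a k * conj (u k - v k) := by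
    rw [← Finset.sum_add_distrib]
    exact Finset.sum_congr rfl fun k _ => by rw [map_sub]; ring
  rw [h1]
  refine (norm_add_le _ _).trans (add_le_add_right ?_ _)
  refine (norm_sum_le _ _).trans ((Finset.sum_le_card_nsmul _ _ η fun k hk => ?_).trans
    (by simp [mul_comm]))
  rw [norm_mul, RCLike.norm_conj]
  exact (mul_le_of_le_one_left (norm_nonneg _) (ha k)).trans (huv k (Finset.mem_range.1 hk))

/-- The index of the point nearest to `z` among the first `n + 1` terms of a dense sequence. -/
noncomputable def quantize (n : ℕ) (z : ℂ) : ℕ :=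
  SimpleFunc.nearestPtInd (TopologicalSpace.denseSeq ℂ) n z

theorem measurable_quantize (n : ℕ) : Measurable (quantize n) :=
  SimpleFunc.measurable _

theorem exists_norm_denseSeq_quantize_sub_le {η : ℝ} (hη : 0 < η) :
    ∃ n, ∀ z : ℂ, ‖z‖ ≤ 1 → ‖TopologicalSpace.denseSeq ℂ (quantize n z) - z‖ ≤ η := by
  obtain ⟨t, ht⟩ := (isCompact_closedBall (0 : ℂ) 1).elim_finite_subcover
    (fun i => Metric.ball (TopologicalSpace.denseSeq ℂ i) η) (fun _ => Metric.isOpen_ball)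
    (fun z _ => by
      obtain ⟨i, hi⟩ := (TopologicalSpace.denseRange_denseSeq ℂ).exists_dist_lt z hη
      exact Set.mem_iUnion.2 ⟨i, hi⟩)
  refine ⟨t.sup id, fun z hz => ?_⟩
  obtain ⟨i, hi, hzi⟩ := Set.mem_iUnion₂.1 (ht (by simpa using hz))
  have h1 := SimpleFunc.edist_nearestPt_le (TopologicalSpace.denseSeq ℂ) z
    (Finset.le_sup (f := id) hi)
  rw [edist_dist, edist_dist, ENNReal.ofReal_le_ofReal_iff dist_nonneg] at h1
  rw [← dist_eq_norm]
  refine le_trans h1 ?_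
  rw [dist_comm]
  exact (Metric.mem_ball.1 hzi).le

section

variable {X : Type*} [MeasurableSpace X] {μ : Measure X} [IsProbabilityMeasure μ] {T : X → X}

theorem exists_measureReal_exists_ge_lt {s : ℕ → Set X} (hs : ∀ n, MeasurableSet (s n))
    (h : ∀ᵐ x ∂μ, ∀ᶠ n in atTop, x ∉ s n) {δ : ℝ} (hδ : 0 < δ) :
    ∃ L, μ.real {x | ∃ l, L ≤ l ∧ x ∈ s l} < δ := by
  have hanti : Antitone fun L => {x | ∃ l, L ≤ l ∧ x ∈ s l} :=
    fun L L' hL x ⟨l, h1, h2⟩ => ⟨l, hL.trans h1, h2⟩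
  have hmeas : ∀ L, MeasurableSet {x | ∃ l, L ≤ l ∧ x ∈ s l} := fun L => by
    have : {x | ∃ l, L ≤ l ∧ x ∈ s l} = ⋃ l, ⋃ (_ : L ≤ l), s l := by ext; simp
    rw [this]
    exact .iUnion fun l => .iUnion fun _ => hs l
  have ht := tendsto_measure_iInter_atTop (μ := μ) (fun L => (hmeas L).nullMeasurableSet) hanti
    ⟨0, measure_ne_top _ _⟩
  have h0 : μ (⋂ L, {x | ∃ l, L ≤ l ∧ x ∈ s l}) = 0 := by
    rw [← compl_compl (⋂ L, {x | ∃ l, L ≤ l ∧ x ∈ s l}), ← mem_ae_iff]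
    filter_upwards [h] with x hx hx'
    obtain ⟨L, hL⟩ := eventually_atTop.1 hx
    obtain ⟨l, h1, h2⟩ := Set.mem_iInter.1 hx' L
    exact hL l h1 h2
  rw [h0] at ht
  have ht' := (ENNReal.tendsto_toReal ENNReal.zero_ne_top).comp ht
  exact (ht'.eventually_lt_const (by simpa using hδ)).exists

/-- The points whose orbit under `f`, quantized and cut at length `M`, lies in `S`. -/
def patternSet (T : X → X) (f : X → ℂ) (n M : ℕ) (S : Finset (Fin M → ℕ)) : Set X :=
  (fun ξ => fun i : Fin M => quantize n (f (T^[i] ξ))) ⁻¹' (S : Set (Fin M → ℕ))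

theorem measurableSet_patternSet (hT : Measurable T) {f : X → ℂ} (hf : Measurable f) (n M : ℕ)
    (S : Finset (Fin M → ℕ)) : MeasurableSet (patternSet T f n M S) := by
  have h : Measurable fun ξ => fun i : Fin M => quantize n (f (T^[(i : ℕ)] ξ)) :=
    measurable_pi_iff.2 fun i =>
      (measurable_quantize n).comp (hf.comp (hT.iterate (i : ℕ)))
  have hS : MeasurableSet (S : Set (Fin M → ℕ)) := S.finite_toSet.measurableSet
  exact h hS

-- There are countably many triples `(n, M, S)`, so one null set serves all of them. This permits a
-- later choice of `S` that depends on `x`.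
open Classical in
theorem ae_tendsto_pattern_frequency (hT : Ergodic T μ) {f : X → ℂ} (hf : Measurable f) :
    ∀ᵐ x ∂μ, ∀ (n M : ℕ) (S : Finset (Fin M → ℕ)), Tendsto (fun N : ℕ =>
      (((Finset.range N).filter fun m => T^[m] x ∈ patternSet T f n M S).card : ℝ) / N) atTop
      (𝓝 (μ.real (patternSet T f n M S))) :=
  ae_all_iff.2 fun n => ae_all_iff.2 fun M => ae_all_iff.2 fun S =>
    ae_tendsto_visit_frequency hT (measurableSet_patternSet hT.measurable hf n M S)

/-- For fixed `x`, the `ξ` whose orbit correlates with that of `x` on some window longer than `L₀`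
have measure below `δ`. That set depends on `x`, so genericity is not available for it directly; for
windows of length at most `M`, quantization replaces it by one of countably many pattern sets. -/
theorem ae_isSelfUncorrelated (hT : Ergodic T μ) {f : X → ℂ} (hf : Measurable f)
    (hf1 : ∀ x, ‖f x‖ ≤ 1) (hcor : ∀ᵐ x ∂μ, ∀ᵐ ξ ∂μ, Tendsto (fun N : ℕ =>
      (N : ℂ)⁻¹ * ∑ n ∈ Finset.range N, f (T^[n] x) * conj (f (T^[n] ξ))) atTop (𝓝 0)) :
    ∀ᵐ x ∂μ, IsSelfUncorrelated fun k => f (T^[k] x) := by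
  classical
  filter_upwards [hcor, ae_tendsto_pattern_frequency hT hf] with x hx hgen δ hδ
  set a : ℕ → ℂ := fun k => f (T^[k] x)
  have ha : ∀ k, ‖a k‖ ≤ 1 := fun k => hf1 _
  obtain ⟨q, hq⟩ := exists_norm_denseSeq_quantize_sub_le (η := δ / 4) (by positivity)
  let s : ℕ → Set X := fun l =>
    {ξ | δ / 2 * l < ‖∑ k ∈ Finset.range l, a k * conj (f (T^[k] ξ))‖}
  have hs : ∀ l, MeasurableSet (s l) := fun l =>
    measurableSet_lt measurable_const (Finset.measurable_fun_sum _ fun k _ =>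
      (Complex.continuous_conj.measurable.comp
        (hf.comp (hT.measurable.iterate k))).const_mul _).norm
  obtain ⟨L₀, hL₀⟩ := exists_measureReal_exists_ge_lt (μ := μ) hs (by
    filter_upwards [hx] with ξ hξ
    have h1 := (tendsto_zero_iff_norm_tendsto_zero.1 hξ).eventually_lt_const (half_pos hδ)
    filter_upwards [h1, eventually_gt_atTop 0] with l hl hl0
    have hl0' : (0 : ℝ) < l := by exact_mod_cast hl0
    rw [norm_mul, norm_inv, Complex.norm_natCast, inv_mul_lt_iff₀ hl0'] at hl
    simp only [s, Set.mem_ofPred_eq, not_lt]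
    linarith) hδ
  refine ⟨L₀, fun M => ?_⟩
  let r : (Fin M → ℕ) → ℕ → ℂ := fun w k =>
    if h : k < M then TopologicalSpace.denseSeq ℂ (w ⟨k, h⟩) else 0
  -- The threshold `3 * δ / 4` lies between `δ / 2` and `δ`, leaving room for a quantization error
  -- of `δ / 4` in both directions: `B` contains every `T^m x` with correlation above `δ`, and each
  -- point of `B` has correlation above `δ / 2`.
  let S : Finset (Fin M → ℕ) := (Fintype.piFinset fun _ => Finset.range (q + 1)).filter fun w =>
    ∃ l, L₀ ≤ l ∧ l ≤ M ∧ 3 * δ / 4 * l < ‖∑ k ∈ Finset.range l, a k * conj (r w k)‖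
  set B : Set X := patternSet T f q M S
  have hr : ∀ ξ k, k < M →
      ‖r (fun i : Fin M => quantize q (f (T^[i] ξ))) k - f (T^[k] ξ)‖ ≤ δ / 4 := by
    intro ξ k hk
    simp only [r, dif_pos hk]
    exact hq _ (hf1 _)
  have hB : μ.real B < δ := by
    refine lt_of_le_of_lt (measureReal_mono fun ξ hξ => ?_) hL₀
    obtain ⟨l, h1, h2, h3⟩ := (Finset.mem_filter.1 hξ).2
    refine ⟨l, h1, ?_⟩
    have := norm_sum_mul_conj_sub_le ha (l := l) fun k hk => hr ξ k (by omega)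
    simp only [s, Set.mem_ofPred_eq]
    linarith
  have hcorr : ∀ m, HasLargeCorr a a δ L₀ M m → T^[m] x ∈ B := by
    rintro m ⟨l, h1, h2, h3⟩
    refine Finset.mem_filter.2 ⟨?_, l, h1, h2, ?_⟩
    · simp only [Fintype.mem_piFinset, Finset.mem_range, Nat.lt_succ_iff]
      exact fun i => SimpleFunc.nearestPtInd_le _ _ _
    · have := norm_sum_mul_conj_sub_le ha (l := l) (η := δ / 4)
        (u := fun k => f (T^[k] (T^[m] x)))
        (v := r (fun i : Fin M => quantize q (f (T^[i] (T^[m] x))))) fun k hk => by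
          rw [norm_sub_rev]; exact hr _ k (by omega)
      simp only [a, add_comm m, Function.iterate_add_apply] at h3
      simp only [a] at this ⊢
      linarith
  filter_upwards [(hgen q M S).eventually_lt_const hB, eventually_gt_atTop 0] with N hN hN0
  have hN0' : (0 : ℝ) < N := by exact_mod_cast hN0
  rw [div_lt_iff₀ hN0'] at hN
  refine le_trans ?_ hN.le
  exact_mod_cast Finset.card_le_card
    (Finset.monotone_filter_right _ fun m _ hm => hcorr m hm)

end

/-! ### Normalization and conclusion -/

theorem exists_measurable_norm_le_one_of_memLp_top {X : Type*} [MeasurableSpace X] {μ : Measure X}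
    {f : X → ℂ} (hf : MemLp f ⊤ μ) :
    ∃ (C : ℂ) (f₁ : X → ℂ), C ≠ 0 ∧ Measurable f₁ ∧ (∀ x, ‖f₁ x‖ ≤ 1) ∧
      f =ᵐ[μ] fun x => C * f₁ x := by
  obtain ⟨F, hF, hfF⟩ := hf.aestronglyMeasurable
  set c : ℝ := (eLpNorm f ⊤ μ).toReal + 1
  have hc : 0 < c := by positivity
  have hb : ∀ᵐ x ∂μ, ‖f x‖ ≤ c := by
    filter_upwards [ae_le_eLpNormEssSup (f := f) (μ := μ)] with x hx
    rw [← eLpNorm_exponent_top] at hx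
    have := ENNReal.toReal_mono hf.eLpNorm_ne_top hx
    rw [toReal_enorm] at this
    linarith
  have hm : MeasurableSet {x | ‖F x‖ ≤ c} := measurableSet_le hF.measurable.norm measurable_const
  refine ⟨c, {x | ‖F x‖ ≤ c}.indicator fun x => (c : ℂ)⁻¹ * F x, by exact_mod_cast hc.ne',
    (hF.measurable.const_mul _).indicator hm, fun x => ?_, ?_⟩
  · by_cases hx : x ∈ {x | ‖F x‖ ≤ c}
    · rw [Set.indicator_of_mem hx, norm_mul, norm_inv, Complex.norm_real,
        Real.norm_of_nonneg hc.le, inv_mul_le_iff₀ hc, mul_one]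
      exact hx
    · rw [Set.indicator_of_notMem hx]
      simp
  · filter_upwards [hfF, hb] with x h1 h2
    rw [h1] at h2
    rw [Set.indicator_of_mem (show x ∈ {x | ‖F x‖ ≤ c} from h2), h1,
      mul_inv_cancel_left₀ (by exact_mod_cast hc.ne')]

theorem ae_isSelfUncorrelated_of_orthogonal_kroneckerFactor {X : Type*} [MeasurableSpace X]
    {μ : Measure X} [IsProbabilityMeasure μ] {T : X → X} (hT : Ergodic T μ) {f f₁ : X → ℂ}
    (hf : MemLp f 2 μ) (hfK : hf.toLp f ∈ (kroneckerFactor hT.toMeasurePreserving)ᗮ) {C : ℂ}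
    (hC : C ≠ 0) (hf₁ : Measurable f₁) (hf₁b : ∀ x, ‖f₁ x‖ ≤ 1)
    (hff₁ : f =ᵐ[μ] fun x => C * f₁ x) :
    ∀ᵐ x ∂μ, IsSelfUncorrelated fun k => f₁ (T^[k] x) := by
  have hf2 : MemLp f₁ 2 μ := MemLp.of_bound hf₁.aestronglyMeasurable 1 (.of_forall hf₁b)
  have heq : hf2.toLp f₁ = C⁻¹ • hf.toLp f := by
    rw [← MemLp.toLp_const_smul]
    refine MemLp.toLp_congr _ _ ?_
    filter_upwards [hff₁] with x hx
    rw [Pi.smul_apply, hx, smul_eq_mul, inv_mul_cancel_left₀ hC]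
  exact ae_isSelfUncorrelated hT hf₁ hf₁b (ae_ae_tendsto_correlation_zero hT.toMeasurePreserving
    hf₁ hf₁b hf2 (heq ▸ Submodule.smul_mem _ _ hfK))

theorem ae_forall_iterate {X : Type*} [MeasurableSpace X] {μ : Measure X} {T : X → X}
    (hT : MeasurePreserving T μ μ) {p : X → Prop} (h : ∀ᵐ x ∂μ, p x) :
    ∀ᵐ x ∂μ, ∀ n, p (T^[n] x) :=
  ae_all_iff.2 fun n => (hT.iterate n).quasiMeasurePreserving.ae h

theorem mainTheorem2 {X : Type u} [MeasurableSpace X] (μ : Measure X)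
    [IsProbabilityMeasure μ] (T : X → X) (hT : Ergodic T μ) (hTinv : IsInvertibleMod T μ)
    (f : X → ℂ) (hf : MemLp f ⊤ μ)
    (hfK : (hf.mono_exponent (le_top : (2 : ENNReal) ≤ ⊤)).toLp f ∈
      (kroneckerFactor hT.toMeasurePreserving)ᗮ) :
    ∃ X' : Set X, MeasurableSet X' ∧ μ X' = 1 ∧
      ∀ (Y : Type v) [MeasurableSpace Y] (ν : Measure Y) [IsProbabilityMeasure ν] (S : Y → Y),
        Ergodic S ν → IsInvertibleMod S ν →
        ∀ g : Y → ℂ, MemLp g ⊤ ν →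
        ∀ x ∈ X', ∀ᵐ y ∂ν,
          Tendsto (fun N : ℕ => (1 / (N : ℂ)) * ∑ n ∈ Finset.Icc 1 N, f (T^[n] x) * g (S^[n] y))
            atTop (𝓝 0) := by
  obtain ⟨C, f₁, hC, hf₁, hf₁b, hff₁⟩ := exists_measurable_norm_le_one_of_memLp_top hf
  have hu := ae_forall_iterate hT.toMeasurePreserving
    (ae_isSelfUncorrelated_of_orthogonal_kroneckerFactor hT _ hfK hC hf₁ hf₁b hff₁)
  -- `f` agrees with `C * f₁` only almost everywhere, so agreement is required along the whole
  -- orbit.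
  obtain ⟨X', hX', hX'm, hgood⟩ :=
    ((ae_forall_iterate hT.toMeasurePreserving hff₁).and hu).exists_measurable_mem
  refine ⟨X', hX'm, prob_compl_eq_zero_iff hX'm |>.1 (mem_ae_iff.1 hX'), ?_⟩
  intro Y _ ν _ S hS _ g hg x hx
  obtain ⟨hfx, hux⟩ := hgood x hx
  obtain ⟨D, g₁, -, hg₁, hg₁b, hgg₁⟩ := exists_measurable_norm_le_one_of_memLp_top hg
  have hlim := ae_forall_iterate hS.toMeasurePreserving (ae_tendsto_of_isSelfUncorrelated
    hS.toMeasurePreserving (fun k => hf₁b _) (hux 1) hg₁ hg₁b)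
  filter_upwards [ae_forall_iterate hS.toMeasurePreserving hgg₁, hlim] with y hgy hy
  -- The sums in the theorem start at `n = 1`, those above at `k = 0`; hence the base points `T x`
  -- and `S y`.
  have h := (hy 1).const_mul (C * D)
  rw [mul_zero] at h
  refine h.congr fun N => ?_
  have hsum : ∑ n ∈ Finset.Icc 1 N, f (T^[n] x) * g (S^[n] y) =
      ∑ k ∈ Finset.range N, C * D * (f₁ (T^[k] (T^[1] x)) * g₁ (S^[k] (S^[1] y))) := by
    rw [← Finset.Ico_succ_right_eq_Icc, Finset.sum_Ico_eq_sum_range]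
    refine Finset.sum_congr (by simp) fun k _ => ?_
    rw [hfx, hgy, add_comm 1 k, Function.iterate_add_apply, Function.iterate_add_apply]
    ring
  rw [hsum, ← Finset.mul_sum, one_div]
  ring
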